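/- **Setting.** A (one-sided) subshift over a finite alphabet $A$ is a closed set $X\subset A^{\mathbb N}$ with $\sigma(X)\subset X$, where $\sigma$ is the shift. For a finite word $w$ let $[w]\subset X$ be the set of points of $X$ that begin with $w$. The language $\mathcal L(X)$ is the set of words with $[w]\ne\emptyset$, and $h_{\mathrm{top}}(X)=\limsup_{n\to\infty}\frac1n\log\#\{w\in\mathcal L(X): |w|=n\}$. For sets of words $\mathcal D,\mathcal E$ write $\mathcal D\mathcal E=\{vw\in\mathcal L(X): v\in\mathcal D,\ w\in\mathcal E\}$. For continuous $\varphi:X\to\mathbb R$ put $S_n\varphi=\sum_{k<n}\varphi\circ\sigma^k$; $\varphi$ is *Bowen on* a set of words $\mathcal G$ if $\sup\{|S_{|w|}\varphi(x)-S_{|w|}\varphi(y)| : w\in\mathcal G,\ x,y\in[w]\}<\infty$. An *equilibrium state* for $\varphi$ is a $\sigma$-invariant Borel probability measure $\mu$ on $X$ that attains $\sup_\nu\big(h(\nu)+\int\varphi\,d\nu\big)$, the supremum over all $\sigma$-invariant Borel probability measures $\nu$ on $X$, where $h$ is the Kolmogorov–Sinai entropy. **The $\beta$-shift.** Let $\beta>1$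 and let $w^\beta=w^\beta_1w^\beta_2\cdots$ be the expansion of $1$ in base $\beta$ given by $t_0=1$, $w^\beta_j=\lceil\beta t_{j-1}\rceil-1$, $t_j=\beta t_{j-1}-w^\beta_j$ (the greedy expansion if that does not terminate, and the infinite quasi-greedy expansion otherwise). The $\beta$-shift is $$\Sigma_\beta=\{x\in\{0,\dots,\lceil\beta\rceil-1\}^{\mathbb N}:\ \sigma^k x\preceq w^\beta\text{ lexicographically for all }k\ge0\}.$$ Consider the labelled graph with vertices $v_1,v_2,\dots$, with an edge $v_i\to v_{i+1}$ labelled $w^\beta_i$ and, for each $0\le a<w^\beta_i$, an edge $v_i\to v_1$ labelled $a$. Let $\mathcal G_\beta$ be the set of labels of finite paths from $v_1$ to $v_1$ (including the empty path) and $\mathcal C^s_\beta=\{w^\beta_1\cdots w^\beta_n: n\ge0\}$. **The inherited decomposition.** Let $X$ be a subshift over a finite alphabet $A$ and $\pi:\Sigma_\beta\to X$ a factor map (continuous, surjective, $\pi\sigma=\sigma\pi$). Let $r\ge0$ and $\theta:\{0,\dots,\lceil\beta\rceil-1\}^{r+1}\to A$ be any block code of $\pi$, that is, $\pi(x)_i=\theta(x_i\cdots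 x_{i+r})$ for all $x\in\Sigma_\beta$ and all $i$, and let $\Theta$ be the induced map on words, $\Theta(w_1\cdots w_{n+r})=\theta(w_1\cdots w_{1+r})\cdots\theta(w_n\cdots w_{n+r})$, where words of length at most $r$ are sent to the empty word. Put $$\mathcal G=\Theta(\mathcal G_\beta),\qquad \mathcal C^s=\{\Theta(uc):\ |u|\le r,\ c\in\mathcal C^s_\beta,\ uc\in\mathcal L(\Sigma_\beta)\}.$$ **Theorem.** In this situation $\mathcal L(X)=\mathcal G\,\mathcal C^s$. If moreover $\varphi\in C(X)$ is Bowen on $\mathcal G$ and $\sup\varphi-\inf\varphi<h_{\mathrm{top}}(X)$, then $\varphi$ has a unique equilibrium state. -/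

import Mathlib

open MeasureTheory Filter Topology

noncomputable section

/-- A one-sided subshift over the alphabet `A`: a closed subset of `A^ℕ`
which is mapped into itself by the shift `(σ x)_i = x_{i+1}`. -/
structure Subshift (A : Type*) [TopologicalSpace A] where
  carrier : Set (ℕ → A)
  isClosed : IsClosed carrier
  shift_mem : ∀ x ∈ carrier, (fun i => x (i + 1)) ∈ carrier

namespace Subshift

variable {A : Type*} [TopologicalSpace A]

instance : CoeSort (Subshift A) (Type _) := ⟨fun X => X.carrier⟩

/-- The shift map `σ : X → X`. -/
noncomputable def shift (X : Subshift A) (x : X) : X := ⟨fun i => x.1 (i + 1), X.shift_mem x.1 x.2⟩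

/-- The cylinder `[w] ⊆ X` of all points of `X` that begin with the word `w`. -/
def cylinder (X : Subshift A) (w : List A) : Set X :=
  {x | ∀ (i : ℕ) (h : i < w.length), x.1 i = w[i]}

/-- The language of `X`: the words with non-empty cylinder. -/
def language (X : Subshift A) : Set (List A) := {w | (X.cylinder w).Nonempty}

/-- The set of all words of the language of `X` of the form `vw` with `v ∈ D` and `w ∈ E`. -/
def concat (X : Subshift A) (D E : Set (List A)) : Set (List A) :=
  {u | u ∈ X.language ∧ ∃ v ∈ D, ∃ w ∈ E, u = v ++ w}

/-- Topological entropy: the exponential growth rate of the number of words of length `n`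
in the language. -/
def topEntropy (X : Subshift A) : EReal :=
  limsup (fun n : ℕ =>
    ((Real.log ({w | w ∈ X.language ∧ w.length = n}.ncard : ℝ) / n : ℝ) : EReal)) atTop

/-- The Bowen property of `φ` on a collection `G` of words: the ergodic sums `S_n φ`
vary by at most a constant on the cylinders of words in `G` of length `n`, for every `n`. -/
def HasBowenOn (X : Subshift A) (G : Set (List A)) (φ : X → ℝ) : Prop :=
  ∃ K : ℝ, ∀ w ∈ G, ∀ x ∈ X.cylinder w, ∀ y ∈ X.cylinder w,
    |birkhoffSum X.shift φ w.length x - birkhoffSum X.shift φ w.length y| ≤ K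

end Subshift

/-! ### Measure-theoretic entropy and equilibrium states -/

/-- The Shannon entropy of the `n`-th refinement `ξ ∨ T⁻¹ξ ∨ ⋯ ∨ T^{-(n-1)}ξ` of the finite
partition of `Ω` into the level sets of `ξ`. -/
def refinedEntropy {Ω : Type*} [MeasurableSpace Ω] (T : Ω → Ω) (μ : Measure Ω) {k : ℕ}
    (ξ : Ω → Fin k) (n : ℕ) : ℝ :=
  ∑ s : Fin n → Fin k, Real.negMulLog (μ.real {x | ∀ i : Fin n, ξ (T^[(i : ℕ)] x) = s i})

/-- The Kolmogorov–Sinai entropy of `T` with respect to `μ`: the supremum of the entropy rates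
over all finite measurable partitions. -/
def ksEntropy {Ω : Type*} [MeasurableSpace Ω] (T : Ω → Ω) (μ : Measure Ω) : EReal :=
  ⨆ (k : ℕ) (ξ : Ω → Fin k) (_ : Measurable ξ),
    limsup (fun n : ℕ => ((refinedEntropy T μ ξ n / n : ℝ) : EReal)) atTop

/-- `μ` is a shift-invariant Borel probability measure on `X`. -/
def IsInvariantProbability {A : Type*} [TopologicalSpace A] [MeasurableSpace A]
    (X : Subshift A) (μ : Measure X) : Prop :=
  IsProbabilityMeasure μ ∧ MeasurePreserving X.shift μ μ

/-- `μ` is an equilibrium state for `φ`: an invariant probability measure that attains the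
supremum of `h(ν) + ∫ φ dν` over all invariant probability measures `ν`. -/
def IsEquilibriumState {A : Type*} [TopologicalSpace A] [MeasurableSpace A]
    (X : Subshift A) (φ : X → ℝ) (μ : Measure X) : Prop :=
  IsInvariantProbability X μ ∧
    ∀ ν : Measure X, IsInvariantProbability X ν →
      ksEntropy X.shift ν + ((∫ x, φ x ∂ν : ℝ) : EReal) ≤
        ksEntropy X.shift μ + ((∫ x, φ x ∂μ : ℝ) : EReal)

/-! ### The `β`-shift -/

/-- The remainders `t_0 = 1`, `t_{j+1} = β t_j - (⌈β t_j⌉ - 1)` of the expansion of `1`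
in base `β`. -/
def betaRemainder (β : ℝ) : ℕ → ℝ
  | 0 => 1
  | j + 1 => β * betaRemainder β j - ((⌈β * betaRemainder β j⌉₊ - 1 : ℕ) : ℝ)

/-- The digits `⌈β t_j⌉ - 1` of the expansion `w^β` of `1` in base `β > 1` (indexed from `0`).
If the greedy expansion of `1`, with digits `⌊β t_j⌋`, does not terminate, then no `β t_j` is
an integer and this is the greedy expansion. If the greedy expansion terminates, then this is
the usual infinite (quasi-greedy) expansion, with digits in `{0, …, ⌈β⌉ - 1}`. -/
noncomputable def betaDigit (β : ℝ) (j : ℕ) : ℕ := ⌈β * betaRemainder β j⌉₊ - 1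

/-- The condition `σ^k x ⪯ w^β` for all `k ≥ 0`, in the lexicographic order. -/
def IsBetaAdmissible (β : ℝ) (x : ℕ → Fin ⌈β⌉₊) : Prop :=
  ∀ k : ℕ, toLex (fun i => (x (k + i) : ℕ)) ≤ toLex (betaDigit β)

theorem isClosed_le_toLex (w : ℕ → ℕ) : IsClosed {y : ℕ → ℕ | toLex y ≤ toLex w} := by
  rw [← isOpen_compl_iff, isOpen_iff_forall_mem_open]
  intro y hy
  have hlt : toLex w < toLex y := not_le.mp hy
  obtain ⟨n, hn, hlt⟩ := hlt
  refine ⟨⋂ i ∈ Finset.range (n + 1), {z : ℕ → ℕ | z i = y i}, ?_, ?_, ?_⟩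
  · intro z hz
    have hz' : ∀ i < n + 1, z i = y i := by simpa using hz
    have hw : toLex w < toLex z := by
      refine ⟨n, fun j hj => ?_, ?_⟩
      · exact (hn j hj).trans (hz' j (Nat.lt_succ_of_lt hj)).symm
      · exact lt_of_lt_of_eq hlt (hz' n (Nat.lt_succ_self n)).symm
    exact not_le.mpr hw
  · refine isOpen_biInter_finset fun i _ => ?_
    have h : IsOpen ((fun z : ℕ → ℕ => z i) ⁻¹' {y i}) :=
      (isOpen_discrete _).preimage (continuous_apply i)
    exact h
  · simp

/-- The `β`-shift `Σ_β ⊆ {0, …, ⌈β⌉ - 1}^ℕ`. -/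
noncomputable def betaShift (β : ℝ) : Subshift (Fin ⌈β⌉₊) where
  carrier := {x | IsBetaAdmissible β x}
  isClosed := by
    simp only [IsBetaAdmissible, Set.ofPred_forall]
    refine isClosed_iInter fun k => (isClosed_le_toLex (betaDigit β)).preimage ?_
    exact continuous_pi fun i => continuous_of_discreteTopology.comp (continuous_apply (k + i))
  shift_mem := by
    intro x hx k
    have h := hx (k + 1)
    have e : (fun i => (x (k + 1 + i) : ℕ)) = fun i => (x (k + i + 1) : ℕ) := by
      funext i
      rw [Nat.add_right_comm]
    rwa [e] at h

/-- `BetaPath β i w j`: the word `w` labels a path from vertex `i` to vertex `j` in the graph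
with vertex set `ℕ` which has, for every vertex `i`, an edge from `i` to `i + 1` labelled by the
digit `w^β_i`, and for every `a < w^β_i` an edge from `i` to `0` labelled by `a`
(the base vertex is `0`, and digits are indexed from `0`). -/
inductive BetaPath (β : ℝ) : ℕ → List (Fin ⌈β⌉₊) → ℕ → Prop
  | nil (i : ℕ) : BetaPath β i [] i
  | advance {i j : ℕ} {a : Fin ⌈β⌉₊} {w : List (Fin ⌈β⌉₊)} (ha : (a : ℕ) = betaDigit β i)
      (h : BetaPath β (i + 1) w j) : BetaPath β i (a :: w) j
  | back {i j : ℕ} {a : Fin ⌈β⌉₊} {w : List (Fin ⌈β⌉₊)} (ha : (a : ℕ) < betaDigit β i)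
      (h : BetaPath β 0 w j) : BetaPath β i (a :: w) j

/-- The good words of the `β`-shift: the labels of paths from the base vertex to itself. -/
def betaCore (β : ℝ) : Set (List (Fin ⌈β⌉₊)) := {w | BetaPath β 0 w 0}

/-- The suffixes for the `β`-shift: the initial words `w^β_1 ⋯ w^β_n`, `n ≥ 0`, of `w^β`. -/
def betaSuffixes (β : ℝ) : Set (List (Fin ⌈β⌉₊)) :=
  {w | ∀ (i : ℕ) (h : i < w.length), (w[i] : ℕ) = betaDigit β i}

/-! ### Factors and inherited decompositions -/

/-- `π : X → Y` is a factor map of subshifts: a continuous surjection commuting with the shifts. -/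
def IsFactorMap {A B : Type*} [TopologicalSpace A] [TopologicalSpace B]
    {X : Subshift A} {Y : Subshift B} (π : X → Y) : Prop :=
  Continuous π ∧ Function.Surjective π ∧ ∀ x, π (X.shift x) = Y.shift (π x)

/-- The block map `θ` on words of length `r + 1` induces `π`:
`π(x)_i = θ(x_i x_{i+1} ⋯ x_{i+r})` for all `x` and `i`. -/
def IsBlockCode {A B : Type*} [TopologicalSpace A] [TopologicalSpace B]
    {X : Subshift A} {Y : Subshift B} (π : X → Y) {r : ℕ} (θ : (Fin (r + 1) → A) → B) : Prop :=
  ∀ (x : X) (i : ℕ), (π x).1 i = θ (fun j => x.1 (i + j))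

/-- The map on words induced by a block map `θ`: a word `w_1 ⋯ w_{n+r}` is sent to the word
`θ(w_1 ⋯ w_{1+r}) ⋯ θ(w_n ⋯ w_{n+r})` of length `n`; words of length at most `r` are sent
to the empty word. -/
noncomputable def blockMap {A B : Type*} {r : ℕ} (θ : (Fin (r + 1) → A) → B)
    (w : List A) : List B :=
  List.ofFn fun i : Fin (w.length - r) => θ fun j : Fin (r + 1) => w[(i : ℕ) + (j : ℕ)]

/-- The good words of a factor of the `β`-shift: the images of the good words of the
`β`-shift. -/
def inheritedCore (β : ℝ) {B : Type*} {r : ℕ} (θ : (Fin (r + 1) → Fin ⌈β⌉₊) → B) :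
    Set (List B) :=
  blockMap θ '' betaCore β

/-- The suffixes for a factor of the `β`-shift: the images of the suffixes `c` of the `β`-shift,
each preceded by the at most `r` symbols that also enter into the windows around its start. -/
def inheritedSuffixes (β : ℝ) {B : Type*} {r : ℕ} (θ : (Fin (r + 1) → Fin ⌈β⌉₊) → B) :
    Set (List B) :=
  {v | ∃ u : List (Fin ⌈β⌉₊), u.length ≤ r ∧ ∃ c ∈ betaSuffixes β,
    u ++ c ∈ (betaShift β).language ∧ v = blockMap θ (u ++ c)}

end

/-! The combinatorial input is that labels of loops at the base vertex of the graph concatenate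
freely, and that every word of the `β`-shift is such a label followed by an initial word of the
expansion of `1`. A block code with window `r + 1` turns this into three facts about the factor:
good words can be glued with gaps of length exactly `r` (`inherited_specification`), every word
splits as good word times suffix (`inherited_decomposition`), and the number of suffixes of a given
length is bounded (`ncard_inheritedSuffixes_le`). They are collected, with the Bowen property, in
`IsGoodDecomposition`; from there on the `β`-shift plays no role.

Let `P` be the growth rate of the partition sums. Since `P` is at least topological entropy plus
`inf φ`, the oscillation condition gives `sup φ < P`. The suffixes grow at rate at most `sup φ`, so
long suffixes are exponentially negligible. Gluing makes the good partition sums supermultiplicative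
up to a constant, so they are `O(exp (nP))`, and then so are the full ones
(`exists_partitionSum_le`). Up to half of its mass, any set of words with partition sum of order
`exp (nP)` consists of words that are good after removal of a bounded suffix (`exists_almostGood`),
and two such sets can be glued (`partitionSum_glue_le`).

Equilibrium states are identified with the invariant measures satisfying `nP ≤ H_n + n ∫ φ` for all
`n`, where `H_n` is the entropy of the words of length `n` (`HasMaximalPressure`). One exists by
averaging optimal measures on words along orbits and taking a weak limit.

For uniqueness it suffices that all of these measures are ergodic: the midpoint of two of them is
again of this kind, hence ergodic, hence extreme in the simplex of invariant measures. If an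
invariant set `E` had measure strictly between `0` and `1`, then words typical for `E` up to one of
`Q` possible times could be glued to words typical for the complement. By Gibbs' inequality and
gluing each switching time yields words of total weight at least a fixed multiple of `exp (NP)`; the
switching time is legible in the word, so the families are disjoint (`disjoint_switchPoints`). For
large `Q` this exceeds the upper bound for the whole partition sum. -/

/-! ### Shannon entropy of random variables with finitely many values -/

/-- The Shannon entropy of a random variable with finitely many values. -/
noncomputable def shannonEntropy {Ω ι : Type*} [MeasurableSpace Ω] [Fintype ι] (μ : Measure Ω)
    (f : Ω → ι) : ℝ :=
  ∑ s, Real.negMulLog (μ.real (f ⁻¹' {s}))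

/-- Gibbs' inequality for a single pair of weights. -/
theorem negMulLog_le_of_weights {p q : ℝ} (hp : 0 ≤ p) (hq : 0 ≤ q) (h : q = 0 → p = 0) :
    Real.negMulLog p ≤ -p * Real.log q + q - p := by
  rcases hp.eq_or_lt with rfl | hp
  · simpa using hq
  have hq' : 0 < q := hq.lt_of_ne fun e => hp.ne' (h e.symm)
  have h1 := Real.log_le_sub_one_of_pos (div_pos hq' hp)
  rw [Real.log_div hq'.ne' hp.ne'] at h1
  have h2 := mul_le_mul_of_nonneg_left h1 hp.le
  have h3 : p * (q / p - 1) = q - p := by field_simp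
  rw [h3] at h2
  rw [Real.negMulLog]
  linarith

/-- Each summand is at most the sum and the logarithm is monotone. This is why merging values of a
random variable cannot increase its entropy. -/
theorem negMulLog_sum_le {ι : Type*} (t : Finset ι) (p : ι → ℝ) (hp : ∀ i ∈ t, 0 ≤ p i) :
    Real.negMulLog (∑ i ∈ t, p i) ≤ ∑ i ∈ t, Real.negMulLog (p i) := by
  rw [Real.negMulLog, neg_mul, Finset.sum_mul, ← Finset.sum_neg_distrib]
  refine Finset.sum_le_sum fun i hi => ?_
  rw [Real.negMulLog, neg_mul, neg_le_neg_iff]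
  rcases (hp i hi).eq_or_lt with h | h
  · simp [← h]
  · exact mul_le_mul_of_nonneg_left
      (Real.log_le_log h (Finset.single_le_sum (f := p) hp hi)) h.le

section
variable {Ω ι κ : Type*} [MeasurableSpace Ω] [Fintype ι]

theorem shannonEntropy_nonneg (μ : Measure Ω) [IsProbabilityMeasure μ] (f : Ω → ι) :
    0 ≤ shannonEntropy μ f :=
  Finset.sum_nonneg fun _ _ => Real.negMulLog_nonneg measureReal_nonneg measureReal_le_one

variable [MeasurableSpace ι] [MeasurableSingletonClass ι]

theorem sum_measureReal_fiber_comp (μ : Measure Ω) [IsFiniteMeasure μ] [DecidableEq κ]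
    {f : Ω → ι} (hf : Measurable f) (g : ι → κ) (t : κ) :
    μ.real ((fun x => g (f x)) ⁻¹' {t}) = ∑ s with g s = t, μ.real (f ⁻¹' {s}) := by
  rw [← measureReal_biUnion_finset]
  · congr 1
    ext x
    simp
  · intro a _ b _ hab
    refine Set.disjoint_left.mpr fun x hx hy => hab ?_
    simp only [Set.mem_preimage, Set.mem_singleton_iff] at hx hy
    exact hx.symm.trans hy
  · exact fun s _ => hf (measurableSet_singleton s)

theorem sum_measureReal_fiber (μ : Measure Ω) [IsProbabilityMeasure μ]
    {f : Ω → ι} (hf : Measurable f) : ∑ s, μ.real (f ⁻¹' {s}) = 1 := by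
  have h := sum_measureReal_fiber_comp μ hf (fun _ => ()) ()
  simpa using h.symm

theorem shannonEntropy_comp_le [Fintype κ] (μ : Measure Ω) [IsFiniteMeasure μ]
    {f : Ω → ι} (hf : Measurable f) (g : ι → κ) :
    shannonEntropy μ (fun x => g (f x)) ≤ shannonEntropy μ f := by
  classical
  unfold shannonEntropy
  rw [← Finset.sum_fiberwise Finset.univ g (fun s => Real.negMulLog (μ.real (f ⁻¹' {s})))]
  refine Finset.sum_le_sum fun t _ => ?_
  rw [sum_measureReal_fiber_comp μ hf g t]
  exact negMulLog_sum_le _ _ fun _ _ => measureReal_nonneg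

/-- Gibbs' inequality for the joint law against the product of its marginals. The product vanishes
only where the joint law does, so the logarithms split. -/
theorem shannonEntropy_prod_le [Fintype κ] [MeasurableSpace κ]
    [MeasurableSingletonClass κ] (μ : Measure Ω) [IsProbabilityMeasure μ]
    {f : Ω → ι} (hf : Measurable f) {g : Ω → κ} (hg : Measurable g) :
    shannonEntropy μ (fun x => (f x, g x)) ≤ shannonEntropy μ f + shannonEntropy μ g := by
  classical
  have hfg : Measurable fun x => (f x, g x) := hf.prodMk hg
  set p : ι × κ → ℝ := fun s => μ.real ((fun x => (f x, g x)) ⁻¹' {s}) with hp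
  set a : ι → ℝ := fun s => μ.real (f ⁻¹' {s}) with ha
  set b : κ → ℝ := fun s => μ.real (g ⁻¹' {s}) with hb
  have hpa : ∀ s, p s ≤ a s.1 := fun s =>
    measureReal_mono fun x hx => by
      simp only [Set.mem_preimage, Set.mem_singleton_iff] at hx ⊢
      rw [← hx]
  have hpb : ∀ s, p s ≤ b s.2 := fun s =>
    measureReal_mono fun x hx => by
      simp only [Set.mem_preimage, Set.mem_singleton_iff] at hx ⊢
      rw [← hx]
  have hp0 : ∀ s, 0 ≤ p s := fun s => measureReal_nonneg
  have ha0 : ∀ s, 0 ≤ a s := fun s => measureReal_nonneg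
  have hb0 : ∀ s, 0 ≤ b s := fun s => measureReal_nonneg
  have ha1 : ∀ i, ∑ j, p (i, j) = a i := by
    intro i
    have h := sum_measureReal_fiber_comp μ hfg Prod.fst i
    simp only [ha] at h ⊢
    rw [h, Finset.sum_filter, Fintype.sum_prod_type, Finset.sum_eq_single i]
    · simp [hp]
    · intro k _ hk
      simp [hk]
    · simp
  have hb1 : ∀ j, ∑ i, p (i, j) = b j := by
    intro j
    have h := sum_measureReal_fiber_comp μ hfg Prod.snd j
    simp only [hb] at h ⊢
    rw [h, Finset.sum_filter, Fintype.sum_prod_type_right, Finset.sum_eq_single j]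
    · simp [hp]
    · intro k _ hk
      simp [hk]
    · simp
  have key : ∀ s : ι × κ, Real.negMulLog (p s) ≤
      -p s * Real.log (a s.1) + -p s * Real.log (b s.2) + a s.1 * b s.2 - p s := by
    intro s
    rcases (hp0 s).eq_or_lt with h | h
    · rw [← h]
      simpa using mul_nonneg (ha0 s.1) (hb0 s.2)
    · have h1 := h.trans_le (hpa s)
      have h2 := h.trans_le (hpb s)
      have h3 := negMulLog_le_of_weights h.le (mul_pos h1 h2).le
        (fun e => absurd e (mul_pos h1 h2).ne')
      rw [Real.log_mul h1.ne' h2.ne'] at h3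
      linarith
  have h1 : ∑ s : ι × κ, -p s * Real.log (a s.1) = shannonEntropy μ f := by
    rw [Fintype.sum_prod_type]
    refine Finset.sum_congr rfl fun i _ => ?_
    dsimp only
    rw [← Finset.sum_mul, Finset.sum_neg_distrib, ha1]
    rfl
  have h2 : ∑ s : ι × κ, -p s * Real.log (b s.2) = shannonEntropy μ g := by
    rw [Fintype.sum_prod_type_right]
    refine Finset.sum_congr rfl fun i _ => ?_
    dsimp only
    rw [← Finset.sum_mul, Finset.sum_neg_distrib, hb1]
    rfl
  have h3 : ∑ s : ι × κ, a s.1 * b s.2 = 1 := by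
    rw [Fintype.sum_prod_type, ← Fintype.sum_mul_sum]
    simp only [ha, hb]
    rw [sum_measureReal_fiber μ hf, sum_measureReal_fiber μ hg, one_mul]
  have h4 : ∑ s, p s = 1 := sum_measureReal_fiber μ hfg
  calc shannonEntropy μ (fun x => (f x, g x)) = ∑ s, Real.negMulLog (p s) := rfl
    _ ≤ ∑ s : ι × κ, (-p s * Real.log (a s.1) + -p s * Real.log (b s.2) + a s.1 * b s.2 - p s) :=
        Finset.sum_le_sum fun s _ => key s
    _ = shannonEntropy μ f + shannonEntropy μ g := by
        rw [Finset.sum_sub_distrib, Finset.sum_add_distrib, Finset.sum_add_distrib, h1, h2, h3, h4]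
        ring

/-- Gibbs' inequality against the uniform distribution. -/
theorem shannonEntropy_le_log_card (μ : Measure Ω) [IsProbabilityMeasure μ]
    {f : Ω → ι} (hf : Measurable f) : shannonEntropy μ f ≤ Real.log (Fintype.card ι) := by
  have hne : Nonempty ι := by
    obtain ⟨x⟩ : Nonempty Ω := nonempty_of_isProbabilityMeasure μ
    exact ⟨f x⟩
  have hc : (0 : ℝ) < Fintype.card ι := by exact_mod_cast Fintype.card_pos
  have h1 := sum_measureReal_fiber μ hf
  calc shannonEntropy μ f
      ≤ ∑ s : ι, (-μ.real (f ⁻¹' {s}) * Real.log ((Fintype.card ι : ℝ)⁻¹) +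
          (Fintype.card ι : ℝ)⁻¹ - μ.real (f ⁻¹' {s})) :=
        Finset.sum_le_sum fun s _ => negMulLog_le_of_weights measureReal_nonneg
          (inv_pos.mpr hc).le (fun e => absurd e (inv_pos.mpr hc).ne')
    _ = Real.log (Fintype.card ι) := by
        rw [Finset.sum_sub_distrib, Finset.sum_add_distrib, ← Finset.sum_mul,
          Finset.sum_neg_distrib, h1, Real.log_inv]
        simp [hc.ne']

end

/-- Concavity of the Shannon entropy in the distribution. -/
theorem sum_shannonEntropy_le {Ω Ω' ι γ : Type*} [MeasurableSpace Ω] [MeasurableSpace Ω']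
    [Fintype ι] (I : Finset γ) (c : γ → ℝ) (hc : ∀ i ∈ I, 0 ≤ c i) (hc1 : ∑ i ∈ I, c i = 1)
    (μ : Measure Ω) (f : Ω → ι) (ν : γ → Measure Ω') (g : γ → Ω' → ι)
    (h : ∀ s, μ.real (f ⁻¹' {s}) = ∑ i ∈ I, c i * (ν i).real (g i ⁻¹' {s})) :
    ∑ i ∈ I, c i * shannonEntropy (ν i) (g i) ≤ shannonEntropy μ f := by
  unfold shannonEntropy
  simp_rw [Finset.mul_sum]
  rw [Finset.sum_comm]
  refine Finset.sum_le_sum fun s _ => ?_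
  rw [h s]
  have := Real.concaveOn_negMulLog.le_map_sum (t := I) (w := c)
    (p := fun i => (ν i).real (g i ⁻¹' {s})) hc hc1 (fun i _ => measureReal_nonneg)
  simpa [smul_eq_mul] using this

/-! ### Itineraries and the Kolmogorov–Sinai theorem for subshifts -/

section
variable {Ω ι κ : Type*} [MeasurableSpace Ω] [Fintype ι] [MeasurableSpace ι]
  [MeasurableSingletonClass ι]

theorem shannonEntropy_le_of_determined [Fintype κ] (μ : Measure Ω) [IsProbabilityMeasure μ]
    {f : Ω → ι} (hf : Measurable f) (g : Ω → κ) (h : ∀ x y, f x = f y → g x = g y) :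
    shannonEntropy μ g ≤ shannonEntropy μ f := by
  have hne : Nonempty κ := by
    obtain ⟨x⟩ : Nonempty Ω := nonempty_of_isProbabilityMeasure μ
    exact ⟨g x⟩
  have hfac : Function.FactorsThrough g f := fun x y hxy => h x y hxy
  obtain ⟨e, he⟩ := (Function.factorsThrough_iff g).mp hfac
  have : g = fun x => e (f x) := he
  rw [this]
  exact shannonEntropy_comp_le μ hf e

theorem shannonEntropy_comp_measurePreserving [Fintype κ] {μ : Measure Ω} {T : Ω → Ω}
    (hT : MeasurePreserving T μ μ) {f : Ω → ι} (hf : Measurable f) :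
    shannonEntropy μ (fun x => f (T x)) = shannonEntropy μ f := by
  refine Finset.sum_congr rfl fun s _ => ?_
  congr 1
  exact hT.measureReal_preimage (hf (measurableSet_singleton s)).nullMeasurableSet

end

/-- The first `n` symbols of the itinerary of `x` with respect to the partition `ξ`. -/
def itinerary {Ω ι : Type*} (T : Ω → Ω) (ξ : Ω → ι) (n : ℕ) (x : Ω) : Fin n → ι :=
  fun i => ξ (T^[(i : ℕ)] x)

section
variable {Ω ι : Type*} [MeasurableSpace Ω]

theorem refinedEntropy_eq_shannonEntropy {k : ℕ} (T : Ω → Ω) (μ : Measure Ω) (ξ : Ω → Fin k)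
    (n : ℕ) : refinedEntropy T μ ξ n = shannonEntropy μ (itinerary T ξ n) := by
  refine Finset.sum_congr rfl fun s _ => ?_
  congr 2
  ext x
  simp [itinerary, funext_iff]

variable [MeasurableSpace ι]

theorem measurable_itinerary {T : Ω → Ω} (hT : Measurable T) {ξ : Ω → ι} (hξ : Measurable ξ)
    (n : ℕ) : Measurable (itinerary T ξ n) :=
  measurable_pi_lambda _ fun i => hξ.comp (hT.iterate i)

variable [Fintype ι] [MeasurableSingletonClass ι]

theorem shannonEntropy_itinerary_add_le {T : Ω → Ω} (hT : Measurable T) {ξ : Ω → ι}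
    (hξ : Measurable ξ) (μ : Measure Ω) [IsProbabilityMeasure μ] (m n : ℕ) :
    shannonEntropy μ (itinerary T ξ (m + n)) ≤
      shannonEntropy μ (itinerary T ξ m) +
        shannonEntropy μ (fun x => itinerary T ξ n (T^[m] x)) := by
  have h1 := measurable_itinerary hT hξ m
  have h2 := (measurable_itinerary hT hξ n).comp (hT.iterate m)
  refine (shannonEntropy_le_of_determined μ (h1.prodMk h2) _ ?_).trans
    (shannonEntropy_prod_le μ h1 h2)
  intro x y hxy
  obtain ⟨ha, hb⟩ := Prod.mk.inj hxy
  funext i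
  rcases lt_or_ge (i : ℕ) m with hi | hi
  · exact congrFun ha ⟨i, hi⟩
  · have := congrFun hb ⟨i - m, by omega⟩
    simp only [Function.comp, itinerary, ← Function.iterate_add_apply] at this
    rwa [Nat.sub_add_cancel hi] at this

theorem shannonEntropy_itinerary_add_le_of_invariant {T : Ω → Ω} {ξ : Ω → ι}
    (hξ : Measurable ξ) {μ : Measure Ω} [IsProbabilityMeasure μ] (hT : MeasurePreserving T μ μ)
    (m n : ℕ) :
    shannonEntropy μ (itinerary T ξ (m + n)) ≤
      shannonEntropy μ (itinerary T ξ m) + shannonEntropy μ (itinerary T ξ n) := by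
  refine (shannonEntropy_itinerary_add_le hT.measurable hξ μ m n).trans_eq ?_
  rw [shannonEntropy_comp_measurePreserving (κ := ι) (hT.iterate m)
    (measurable_itinerary hT.measurable hξ n)]

theorem shannonEntropy_itinerary_mul_le {T : Ω → Ω} {ξ : Ω → ι}
    (hξ : Measurable ξ) {μ : Measure Ω} [IsProbabilityMeasure μ] (hT : MeasurePreserving T μ μ)
    (k n : ℕ) :
    shannonEntropy μ (itinerary T ξ (k * n)) ≤ k * shannonEntropy μ (itinerary T ξ n) := by
  induction k with
  | zero =>
    rw [Nat.zero_mul]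
    refine (shannonEntropy_le_log_card μ (measurable_itinerary hT.measurable hξ 0)).trans ?_
    simp
  | succ k ih =>
    rw [Nat.succ_mul]
    refine (shannonEntropy_itinerary_add_le_of_invariant hξ hT _ _).trans ?_
    push_cast
    linarith

theorem shannonEntropy_itinerary_mono {T : Ω → Ω} (hT : Measurable T) {ξ : Ω → ι}
    (hξ : Measurable ξ) (μ : Measure Ω) [IsProbabilityMeasure μ] {m n : ℕ} (h : m ≤ n) :
    shannonEntropy μ (itinerary T ξ m) ≤ shannonEntropy μ (itinerary T ξ n) :=
  shannonEntropy_le_of_determined μ (measurable_itinerary hT hξ n) _ fun x y hxy => by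
    funext i
    exact congrFun hxy ⟨i, i.2.trans_le h⟩

theorem shannonEntropy_itinerary_le_mul {T : Ω → Ω} {ξ : Ω → ι}
    (hξ : Measurable ξ) {μ : Measure Ω} [IsProbabilityMeasure μ] (hT : MeasurePreserving T μ μ)
    (n : ℕ) : shannonEntropy μ (itinerary T ξ n) ≤ n * shannonEntropy μ ξ := by
  have h := shannonEntropy_itinerary_mul_le hξ hT n 1
  rw [Nat.mul_one] at h
  refine h.trans (mul_le_mul_of_nonneg_left ?_ n.cast_nonneg)
  exact shannonEntropy_le_of_determined μ hξ _ fun x y hxy => by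
    funext i
    simpa [itinerary, Fin.fin_one_eq_zero i] using hxy

end

/-- A random variable which is almost constant has small entropy. -/
theorem exists_shannonEntropy_le (ι : Type*) [Fintype ι] (a : ι) {ε : ℝ} (hε : 0 < ε) :
    ∃ δ > 0, ∀ {Ω : Type*} [MeasurableSpace Ω] (μ : Measure Ω) [IsProbabilityMeasure μ]
      (f : Ω → ι), MeasurableSet (f ⁻¹' {a}) → μ.real {x | f x ≠ a} ≤ δ →
      shannonEntropy μ f ≤ ε := by
  have hc : (0 : ℝ) < Fintype.card ι := by
    have : Nonempty ι := ⟨a⟩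
    exact_mod_cast Fintype.card_pos
  have hc0 : Tendsto Real.negMulLog (𝓝 0) (𝓝 0) := by
    simpa using Real.continuous_negMulLog.tendsto 0
  have hc1 : Tendsto Real.negMulLog (𝓝 1) (𝓝 0) := by
    simpa using Real.continuous_negMulLog.tendsto 1
  have hpos : 0 < ε / Fintype.card ι := div_pos hε hc
  obtain ⟨δ₀, hδ₀, h0⟩ := Metric.eventually_nhds_iff.mp (hc0.eventually (gt_mem_nhds hpos))
  obtain ⟨δ₁, hδ₁, h1⟩ := Metric.eventually_nhds_iff.mp (hc1.eventually (gt_mem_nhds hpos))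
  refine ⟨min δ₀ δ₁ / 2, by positivity, ?_⟩
  intro Ω _ μ _ f hf hμ
  have hlt : min δ₀ δ₁ / 2 < min δ₀ δ₁ := half_lt_self (lt_min hδ₀ hδ₁)
  have hall : ∀ s, Real.negMulLog (μ.real (f ⁻¹' {s})) ≤ ε / Fintype.card ι := by
    intro s
    by_cases hs : s = a
    · subst hs
      refine (h1 ?_).le
      have : {x | f x ≠ s} = (f ⁻¹' {s})ᶜ := rfl
      rw [this, probReal_compl_eq_one_sub hf] at hμ
      have hle : μ.real (f ⁻¹' {s}) ≤ 1 := measureReal_le_one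
      rw [Real.dist_eq, abs_sub_comm, abs_of_nonneg (by linarith)]
      exact hμ.trans_lt (hlt.trans_le (min_le_right _ _))
    · refine (h0 ?_).le
      rw [Real.dist_eq, sub_zero, abs_of_nonneg measureReal_nonneg]
      refine (measureReal_mono fun x hx => ?_).trans_lt
        (hμ.trans_lt (hlt.trans_le (min_le_left _ _)))
      have hx' : f x = s := hx
      exact fun e => hs (hx'.symm.trans e)
  calc shannonEntropy μ f ≤ ∑ _s : ι, ε / Fintype.card ι := Finset.sum_le_sum fun s _ => hall s
    _ = ε := by
      rw [Finset.sum_const, Finset.card_univ, nsmul_eq_mul]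
      field_simp

/-! ### Words of points, cylinder sets, and approximation of Borel sets -/

namespace Subshift

variable {A : Type*} [TopologicalSpace A]

/-- The initial word of length `n` of a point. -/
def word (X : Subshift A) (n : ℕ) (x : X) : Fin n → A := fun i => x.1 i

theorem iterate_shift_apply (X : Subshift A) (k : ℕ) (x : X) (i : ℕ) :
    (X.shift^[k] x).1 i = x.1 (i + k) := by
  induction k generalizing x with
  | zero => rfl
  | succ k ih =>
    rw [Function.iterate_succ_apply, ih]
    exact congrArg x.1 (by omega)

theorem word_eq_iff (X : Subshift A) {n : ℕ} {x y : X} :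
    X.word n x = X.word n y ↔ ∀ i < n, x.1 i = y.1 i :=
  ⟨fun h i hi => congrFun h ⟨i, hi⟩, fun h => funext fun i => h i i.2⟩

theorem word_mono (X : Subshift A) {m n : ℕ} (h : m ≤ n) {x y : X}
    (hxy : X.word n x = X.word n y) : X.word m x = X.word m y :=
  X.word_eq_iff.mpr fun i hi => X.word_eq_iff.mp hxy i (hi.trans_le h)

theorem word_shift (X : Subshift A) {k n : ℕ} {x y : X}
    (hxy : X.word (k + n) x = X.word (k + n) y) :
    X.word n (X.shift^[k] x) = X.word n (X.shift^[k] y) :=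
  X.word_eq_iff.mpr fun i hi => by
    rw [iterate_shift_apply, iterate_shift_apply]
    exact X.word_eq_iff.mp hxy _ (by omega)

theorem word_eq_itinerary (X : Subshift A) (n : ℕ) :
    X.word n = itinerary X.shift (fun x => x.1 0) n := by
  funext x i
  simp [word, itinerary, iterate_shift_apply]

theorem continuous_shift (X : Subshift A) : Continuous X.shift :=
  Continuous.subtype_mk
    (f := fun x : X => fun i => x.1 (i + 1))
    (continuous_pi fun i => (continuous_apply (i + 1)).comp continuous_subtype_val) _

theorem continuous_word (X : Subshift A) (n : ℕ) : Continuous (X.word n) :=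
  continuous_pi fun i => (continuous_apply (i : ℕ)).comp continuous_subtype_val

/-- A set of points that depends on the initial word of length `l` only. -/
def IsCylinderSet (X : Subshift A) (l : ℕ) (F : Set X) : Prop :=
  ∀ x y, X.word l x = X.word l y → x ∈ F → y ∈ F

theorem IsCylinderSet.mono {X : Subshift A} {l m : ℕ} {F : Set X} (h : X.IsCylinderSet l F)
    (hlm : l ≤ m) : X.IsCylinderSet m F :=
  fun x y hxy => h x y (X.word_mono hlm hxy)

variable [MeasurableSpace A]

theorem measurable_shift (X : Subshift A) : Measurable X.shift :=
  Measurable.subtype_mk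
    (f := fun x : X => fun i => x.1 (i + 1))
    (measurable_pi_lambda _ fun i => (measurable_pi_apply (i + 1)).comp measurable_subtype_coe)

theorem measurable_symbol (X : Subshift A) (i : ℕ) : Measurable fun x : X => x.1 i :=
  (measurable_pi_apply i).comp measurable_subtype_coe

theorem measurable_word (X : Subshift A) (n : ℕ) : Measurable (X.word n) :=
  measurable_pi_lambda _ fun i => X.measurable_symbol i

variable [Finite A] [MeasurableSingletonClass A]

theorem IsCylinderSet.measurableSet {X : Subshift A} {l : ℕ} {F : Set X}
    (h : X.IsCylinderSet l F) : MeasurableSet F := by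
  have : F = X.word l ⁻¹' (X.word l '' F) := by
    ext x
    constructor
    · exact fun hx => ⟨x, hx, rfl⟩
    · rintro ⟨y, hy, hyx⟩
      exact h y x hyx hy
  rw [this]
  exact X.measurable_word l (Set.toFinite _).measurableSet

/-- Every Borel set is approximated in measure by sets depending on finitely many symbols. -/
theorem exists_isCylinderSet_symmDiff_lt (X : Subshift A) (μ : Measure X) [IsFiniteMeasure μ]
    {E : Set X} (hE : MeasurableSet E) {ε : ENNReal} (hε : 0 < ε) :
    ∃ l F, X.IsCylinderSet l F ∧ μ (symmDiff F E) < ε := by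
  let C : Set (Set X) := {F | ∃ l, X.IsCylinderSet l F}
  have hC : IsSetRing C := by
    refine ⟨⟨0, fun _ _ _ h => h⟩, ?_, ?_⟩
    · rintro s t ⟨l, hl⟩ ⟨m, hm⟩
      refine ⟨max l m, fun x y hxy h => ?_⟩
      rcases h with h | h
      · exact Or.inl (hl.mono (le_max_left _ _) x y hxy h)
      · exact Or.inr (hm.mono (le_max_right _ _) x y hxy h)
    · rintro s t ⟨l, hl⟩ ⟨m, hm⟩
      refine ⟨max l m, fun x y hxy h => ?_⟩
      exact ⟨hl.mono (le_max_left _ _) x y hxy h.1,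
        fun hy => h.2 (hm.mono (le_max_right _ _) y x hxy.symm hy)⟩
  have hgen : (inferInstance : MeasurableSpace X) = MeasurableSpace.generateFrom C := by
    apply le_antisymm
    · have : @Measurable _ _ (MeasurableSpace.generateFrom C) _ (fun x : X => x.1) := by
        refine @measurable_pi_lambda _ _ _ (MeasurableSpace.generateFrom C) _ _ fun i => ?_
        intro S _
        refine MeasurableSpace.measurableSet_generateFrom ⟨i + 1, fun x y hxy hx => ?_⟩
        have : x.1 i = y.1 i := X.word_eq_iff.mp hxy i (Nat.lt_succ_self i)
        simpa [Set.mem_preimage, this] using hx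
      exact this.comap_le
    · refine MeasurableSpace.generateFrom_le ?_
      rintro F ⟨l, hl⟩
      exact hl.measurableSet
  obtain ⟨F, ⟨l, hl⟩, hF⟩ := exists_measure_symmDiff_lt_of_generateFrom_isSetRing (μ := μ) hC
    ⟨{Set.univ}, Set.countable_singleton _, by
      rintro _ rfl
      exact ⟨0, fun _ _ _ _ => trivial⟩, by simp⟩ hgen hE hε
  exact ⟨l, F, hl, hF⟩

end Subshift

/-- The entropy of a shift-invariant measure is at most the normalized entropy of the words of
length `n`, for every `n`. -/
theorem Subshift.ksEntropy_le {A : Type*} [Fintype A] [TopologicalSpace A] [MeasurableSpace A]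
    [MeasurableSingletonClass A] (X : Subshift A) (μ : Measure X) [IsProbabilityMeasure μ]
    (hμ : MeasurePreserving X.shift μ μ) {n : ℕ} (hn : n ≠ 0) :
    ksEntropy X.shift μ ≤ ((shannonEntropy μ (X.word n) / n : ℝ) : EReal) := by
  have hn0 : (0 : ℝ) < n := by exact_mod_cast Nat.pos_of_ne_zero hn
  set H := shannonEntropy μ (X.word n) with hH
  refine iSup_le fun k => iSup_le fun ξ => iSup_le fun hξ => ?_
  refine EReal.le_of_forall_lt_iff_le.mp fun z hz => ?_
  have hz' : H / n < z := by exact_mod_cast hz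
  set ε := (z - H / n) / 2 with hε
  have hε0 : 0 < ε := by rw [hε]; linarith
  -- The approximation errors for the `k` cells form a random variable with values in `Fin k → Prop`
  -- that is almost always identically false, so its entropy can be made at most `ε`.
  obtain ⟨δ, hδ, hδH⟩ := exists_shannonEntropy_le (Fin k → Prop) (fun _ => False) hε0
  have happ : ∀ s : Fin k, ∃ l F, X.IsCylinderSet l F ∧
      μ (symmDiff F (ξ ⁻¹' {s})) < ENNReal.ofReal (δ / (k + 1)) := fun s =>
    X.exists_isCylinderSet_symmDiff_lt μ (hξ (measurableSet_singleton s))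
      (ENNReal.ofReal_pos.mpr (by positivity))
  choose l F hF hμF using happ
  let L := Finset.univ.sup l
  have hFL : ∀ s, X.IsCylinderSet L (F s) := fun s =>
    (hF s).mono (Finset.le_sup (Finset.mem_univ s))
  -- `e x s` says that membership in the cylinder set `F s` gives the wrong answer to whether `ξ x =
  -- s`. Knowing `e` and the first `L` symbols therefore determines `ξ`.
  let e : X → Fin k → Prop := fun x s => x ∈ symmDiff (F s) (ξ ⁻¹' {s})
  have hes : ∀ s, MeasurableSet (symmDiff (F s) (ξ ⁻¹' {s})) := fun s =>
    (hF s).measurableSet.symmDiff (hξ (measurableSet_singleton s))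
  have he : Measurable e := measurable_pi_lambda _ fun s => measurableSet_setOfPred.mp (hes s)
  have hHe : shannonEntropy μ e ≤ ε := by
    refine hδH μ e (he (measurableSet_singleton _)) ?_
    have hsub : {x | e x ≠ fun _ => False} ⊆ ⋃ s, symmDiff (F s) (ξ ⁻¹' {s}) := by
      intro x hx
      by_contra hcon
      refine hx (funext fun s => eq_false fun h => hcon (Set.mem_iUnion.mpr ⟨s, h⟩))
    calc μ.real {x | e x ≠ fun _ => False}
        ≤ μ.real (⋃ s, symmDiff (F s) (ξ ⁻¹' {s})) := measureReal_mono hsub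
      _ ≤ ∑ s, μ.real (symmDiff (F s) (ξ ⁻¹' {s})) := measureReal_iUnion_fintype_le _
      _ ≤ ∑ _s : Fin k, δ / (k + 1) := Finset.sum_le_sum fun s _ =>
          ENNReal.toReal_le_of_le_ofReal (by positivity) (hμF s).le
      _ ≤ δ := by
          rw [Finset.sum_const, Finset.card_univ, Fintype.card_fin, nsmul_eq_mul]
          rw [mul_div_assoc', div_le_iff₀ (by positivity)]
          nlinarith
  have hsym := X.measurable_symbol 0
  have hH0 : 0 ≤ H := shannonEntropy_nonneg μ _
  have hbound : ∀ N : ℕ, refinedEntropy X.shift μ ξ N ≤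
      (((N + L : ℕ) : ℝ) / n + 1) * H + N * ε := by
    intro N
    rw [refinedEntropy_eq_shannonEntropy]
    have hm1 := X.measurable_word (N + L)
    have hm2 := measurable_itinerary hμ.measurable he N
    have h1 : shannonEntropy μ (itinerary X.shift ξ N) ≤
        shannonEntropy μ (X.word (N + L)) + shannonEntropy μ (itinerary X.shift e N) := by
      refine (shannonEntropy_le_of_determined μ (hm1.prodMk hm2) _ ?_).trans
        (shannonEntropy_prod_le μ hm1 hm2)
      intro x y hxy
      obtain ⟨ha, hb⟩ := Prod.mk.inj hxy
      funext i
      have hw : X.word L (X.shift^[(i : ℕ)] x) = X.word L (X.shift^[(i : ℕ)] y) :=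
        X.word_shift (X.word_mono (by omega) ha)
      have h2 : e (X.shift^[(i : ℕ)] x) (ξ (X.shift^[(i : ℕ)] x)) =
          e (X.shift^[(i : ℕ)] y) (ξ (X.shift^[(i : ℕ)] x)) := congrFun (congrFun hb i) _
      have h3 := hFL (ξ (X.shift^[(i : ℕ)] x)) _ _ hw
      have h4 := hFL (ξ (X.shift^[(i : ℕ)] x)) _ _ hw.symm
      simp only [e, Set.mem_symmDiff, Set.mem_preimage, Set.mem_singleton_iff, eq_iff_iff] at h2
      simp only [itinerary]
      by_contra hne
      have hne' : ¬ ξ (X.shift^[(i : ℕ)] y) = ξ (X.shift^[(i : ℕ)] x) := fun h => hne h.symm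
      tauto
    have h2 : shannonEntropy μ (itinerary X.shift e N) ≤ N * ε :=
      (shannonEntropy_itinerary_le_mul he hμ N).trans
        (mul_le_mul_of_nonneg_left hHe N.cast_nonneg)
    have h3 : shannonEntropy μ (X.word (N + L)) ≤ (((N + L : ℕ) : ℝ) / n + 1) * H := by
      -- Round `N + L` up to a multiple of `n`, so that subadditivity over blocks of length `n`
      -- applies.
      have h4 : N + L ≤ ((N + L) / n + 1) * n := by
        have := Nat.lt_div_mul_add (a := N + L) (Nat.pos_of_ne_zero hn)
        rw [Nat.succ_mul]
        omega
      have h5 := shannonEntropy_itinerary_mono hμ.measurable hsym μ h4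
      have h6 := shannonEntropy_itinerary_mul_le hsym hμ ((N + L) / n + 1) n
      rw [← X.word_eq_itinerary, ← X.word_eq_itinerary] at h5
      rw [← X.word_eq_itinerary, ← X.word_eq_itinerary] at h6
      refine (h5.trans h6).trans (mul_le_mul_of_nonneg_right ?_ hH0)
      push_cast
      have := @Nat.cast_div_le ℝ _ _ _ (N + L) n
      push_cast at this
      linarith
    linarith
  refine limsup_le_of_le (by isBoundedDefault) ?_
  have hlim : Tendsto (fun N : ℕ => H / n + ε + (L / n + 1) * H / N) atTop (𝓝 (H / n + ε)) := by
    simpa using (tendsto_const_div_atTop_nhds_zero_nat ((L / n + 1) * H)).const_add (H / n + ε)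
  filter_upwards [hlim.eventually (gt_mem_nhds (show H / n + ε < z by rw [hε]; linarith)),
    eventually_gt_atTop 0] with N hN hN0
  have hN0' : (0 : ℝ) < N := by exact_mod_cast hN0
  refine EReal.coe_le_coe_iff.mpr (le_trans ?_ hN.le)
  rw [div_le_iff₀ hN0']
  refine (hbound N).trans_eq ?_
  push_cast
  field_simp
  ring

/-! ### Partition sums -/

open Classical in
/-- A weighted counting principle: if every index of the first sum is related to an index of the
second sum with larger weight, and is determined by the latter and an element of `τ`. -/
theorem sum_le_card_mul_sum_of_rel {ι κ τ : Type*} [Fintype τ] (s : Finset ι) (t : Finset κ)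
    (a : ι → ℝ) (b : κ → ℝ) (hb : ∀ k ∈ t, 0 ≤ b k) (R : ι → κ → τ → Prop)
    (hR : ∀ i ∈ s, a i ≠ 0 → ∃ k ∈ t, ∃ u, a i ≤ b k ∧ R i k u)
    (hinj : ∀ i i' k u, R i k u → R i' k u → i = i') :
    ∑ i ∈ s, a i ≤ Fintype.card τ * ∑ k ∈ t, b k := by
  -- Each term is dominated by a sum over all related pairs. After interchanging the sums, a fixed
  -- pair `k`, `u` is met by at most one `i`.
  have h1 : ∀ i ∈ s, a i ≤ ∑ k ∈ t, ∑ u : τ, if R i k u then b k else 0 := by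
    intro i hi
    have hnn : ∀ k ∈ t, 0 ≤ ∑ u : τ, if R i k u then b k else 0 := fun k hk =>
      Finset.sum_nonneg fun u _ => by split_ifs <;> simp [hb k hk]
    by_cases h0 : a i = 0
    · rw [h0]
      exact Finset.sum_nonneg hnn
    · obtain ⟨k, hk, u, hle, hr⟩ := hR i hi h0
      refine (hle.trans ?_).trans (Finset.single_le_sum hnn hk)
      have := Finset.single_le_sum (f := fun u : τ => if R i k u then b k else 0)
        (fun u _ => by split_ifs <;> simp [hb k hk]) (Finset.mem_univ u)
      simpa [hr] using this
  refine (Finset.sum_le_sum h1).trans ?_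
  rw [Finset.sum_comm, Finset.mul_sum]
  refine Finset.sum_le_sum fun k hk => ?_
  rw [Finset.sum_comm]
  have h2 : ∀ u : τ, (∑ i ∈ s, if R i k u then b k else 0) ≤ b k := by
    intro u
    rw [← Finset.sum_filter, Finset.sum_const, nsmul_eq_mul]
    refine mul_le_of_le_one_left (hb k hk) ?_
    have : (s.filter fun i => R i k u).card ≤ 1 := Finset.card_le_one.mpr fun i hi i' hi' =>
      hinj i i' k u (Finset.mem_filter.mp hi).2 (Finset.mem_filter.mp hi').2
    exact_mod_cast this
  refine (Finset.sum_le_sum fun u _ => h2 u).trans_eq ?_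
  rw [Finset.sum_const, Finset.card_univ, nsmul_eq_mul]

namespace Subshift

variable {A : Type*} [TopologicalSpace A]

instance [Finite A] [DiscreteTopology A] (X : Subshift A) : CompactSpace X :=
  isCompact_iff_compactSpace.mp X.isClosed.isCompact

/-- The weight of a word: the supremum of `exp (S_n φ)` over its cylinder. -/
noncomputable def weight (X : Subshift A) (φ : X → ℝ) (n : ℕ) (w : Fin n → A) : ℝ :=
  ⨆ x : {x : X // X.word n x = w}, Real.exp (birkhoffSum X.shift φ n x)

open Classical in
/-- The partition sum over a set of words of length `n`. -/
noncomputable def partitionSum [Fintype A] (X : Subshift A) (φ : X → ℝ) (n : ℕ)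
    (S : Set (Fin n → A)) : ℝ :=
  ∑ w with w ∈ S, X.weight φ n w

theorem abs_birkhoffSum_le {α : Type*} {T : α → α} {φ : α → ℝ} {b : ℝ} (hb : ∀ x, |φ x| ≤ b)
    (n : ℕ) (x : α) : |birkhoffSum T φ n x| ≤ n * b := by
  refine (Finset.abs_sum_le_sum_abs _ _).trans ?_
  refine (Finset.sum_le_sum fun i _ => hb _).trans_eq ?_
  simp

section weight
variable {X : Subshift A} {φ : X → ℝ} {b : ℝ}

theorem weight_nonneg (n : ℕ) (w : Fin n → A) : 0 ≤ X.weight φ n w :=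
  Real.iSup_nonneg fun _ => (Real.exp_pos _).le

theorem weight_le {n : ℕ} {w : Fin n → A} {c : ℝ} (hc : 0 ≤ c)
    (h : ∀ x, X.word n x = w → Real.exp (birkhoffSum X.shift φ n x) ≤ c) :
    X.weight φ n w ≤ c :=
  Real.iSup_le (fun x => h x.1 x.2) hc

theorem exp_le_weight (hb : ∀ x, |φ x| ≤ b) (n : ℕ) (x : X) :
    Real.exp (birkhoffSum X.shift φ n x) ≤ X.weight φ n (X.word n x) := by
  refine le_ciSup (f := fun y : {y : X // X.word n y = X.word n x} =>
    Real.exp (birkhoffSum X.shift φ n y)) ⟨Real.exp (n * b), ?_⟩ ⟨x, rfl⟩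
  rintro _ ⟨y, rfl⟩
  exact Real.exp_le_exp.mpr ((le_abs_self _).trans (abs_birkhoffSum_le hb n _))

/-- An empty supremum of reals is `0`, so words outside the language have weight zero and sums over
all words are in effect sums over the language. -/
theorem exists_word_eq_of_weight_ne_zero {n : ℕ} {w : Fin n → A} (h : X.weight φ n w ≠ 0) :
    ∃ x, X.word n x = w := by
  by_contra! hcon
  refine h ?_
  have : IsEmpty {x : X // X.word n x = w} := ⟨fun x => hcon x.1 x.2⟩
  exact Real.iSup_of_isEmpty _

variable [Fintype A]

theorem partitionSum_nonneg (n : ℕ) (S : Set (Fin n → A)) : 0 ≤ X.partitionSum φ n S :=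
  Finset.sum_nonneg fun _ _ => weight_nonneg _ _

theorem sum_weight_eq (n : ℕ) : ∑ w, X.weight φ n w = X.partitionSum φ n Set.univ := by
  classical
  rw [partitionSum]
  refine Finset.sum_congr ?_ fun _ _ => rfl
  simp

theorem partitionSum_mono_of_language {n : ℕ} {S T : Set (Fin n → A)}
    (h : ∀ x, X.word n x ∈ S → X.word n x ∈ T) :
    X.partitionSum φ n S ≤ X.partitionSum φ n T := by
  classical
  have := sum_le_card_mul_sum_of_rel (τ := Unit) (Finset.univ.filter (· ∈ S))
    (Finset.univ.filter (· ∈ T)) (X.weight φ n) (X.weight φ n) (fun _ _ => weight_nonneg _ _)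
    (fun i k _ => i = k) (fun w hw h0 => by
      obtain ⟨x, rfl⟩ := exists_word_eq_of_weight_ne_zero h0
      exact ⟨_, by simpa using h x (by simpa using hw), (), le_rfl, rfl⟩)
    (fun _ _ _ _ h1 h2 => h1.trans h2.symm)
  simpa [partitionSum] using this

theorem partitionSum_mono {n : ℕ} {S T : Set (Fin n → A)} (h : S ⊆ T) :
    X.partitionSum φ n S ≤ X.partitionSum φ n T :=
  partitionSum_mono_of_language fun _ hx => h hx

theorem partitionSum_union_le {n : ℕ} (S T : Set (Fin n → A)) :
    X.partitionSum φ n (S ∪ T) ≤ X.partitionSum φ n S + X.partitionSum φ n T := by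
  classical
  simp only [partitionSum, Finset.sum_filter, ← Finset.sum_add_distrib]
  refine Finset.sum_le_sum fun w _ => ?_
  have := weight_nonneg (X := X) (φ := φ) n w
  by_cases h1 : w ∈ S <;> by_cases h2 : w ∈ T <;> simp [h1, h2, this]

theorem partitionSum_iUnion_le {n : ℕ} {γ : Type*} (J : Finset γ) (S : γ → Set (Fin n → A)) :
    X.partitionSum φ n (⋃ j ∈ J, S j) ≤ ∑ j ∈ J, X.partitionSum φ n (S j) := by
  classical
  induction J using Finset.induction_on with
  | empty => simp [partitionSum]
  | insert j J hj ih =>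
    rw [Finset.set_biUnion_insert, Finset.sum_insert hj]
    exact (partitionSum_union_le _ _).trans (by linarith)

/-- Disjointness is needed only for initial words of points, the others being weightless. -/
theorem sum_partitionSum_le_of_disjoint {n : ℕ} {γ : Type*} (J : Finset γ)
    (S : γ → Set (Fin n → A))
    (hd : ∀ i ∈ J, ∀ j ∈ J, ∀ x, X.word n x ∈ S i → X.word n x ∈ S j → i = j) :
    ∑ j ∈ J, X.partitionSum φ n (S j) ≤ X.partitionSum φ n Set.univ := by
  classical
  simp only [partitionSum, Finset.sum_filter]
  rw [Finset.sum_comm]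
  refine Finset.sum_le_sum fun w _ => ?_
  simp only [Set.mem_univ, if_true]
  rw [← Finset.sum_filter, Finset.sum_const, nsmul_eq_mul]
  by_cases h0 : X.weight φ n w = 0
  · simp [h0]
  obtain ⟨x, rfl⟩ := exists_word_eq_of_weight_ne_zero h0
  refine mul_le_of_le_one_left (weight_nonneg _ _) ?_
  have : (J.filter fun i => X.word n x ∈ S i).card ≤ 1 := Finset.card_le_one.mpr fun i hi j hj => by
    simp only [Finset.mem_filter] at hi hj
    exact hd i hi.1 j hj.1 x hi.2 hj.2
  exact_mod_cast this

theorem exp_le_partitionSum (hb : ∀ x, |φ x| ≤ b) (n : ℕ) (x : X) :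
    Real.exp (birkhoffSum X.shift φ n x) ≤ X.partitionSum φ n Set.univ := by
  classical
  refine (exp_le_weight hb n x).trans ?_
  rw [partitionSum]
  refine Finset.single_le_sum (f := X.weight φ n) (fun _ _ => weight_nonneg _ _) ?_
  simp

theorem partitionSum_pos [Nonempty X] (hb : ∀ x, |φ x| ≤ b) (n : ℕ) :
    0 < X.partitionSum φ n Set.univ := by
  obtain ⟨x⟩ := ‹Nonempty X›
  exact (Real.exp_pos _).trans_le (exp_le_partitionSum hb n x)

/-- Birkhoff sums split at time `m`, so weights are submultiplicative, and a word is determined by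
its two pieces. -/
theorem partitionSum_le_mul (hb : ∀ x, |φ x| ≤ b) {m n : ℕ} (U : Set (Fin (m + n) → A))
    (S : Set (Fin m → A)) (T : Set (Fin n → A))
    (h : ∀ x, X.word (m + n) x ∈ U → X.word m x ∈ S ∧ X.word n (X.shift^[m] x) ∈ T) :
    X.partitionSum φ (m + n) U ≤ X.partitionSum φ m S * X.partitionSum φ n T := by
  classical
  have := sum_le_card_mul_sum_of_rel (τ := Unit) (Finset.univ.filter (· ∈ U))
    ((Finset.univ.filter (· ∈ S)) ×ˢ (Finset.univ.filter (· ∈ T))) (X.weight φ (m + n))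
    (fun p => X.weight φ m p.1 * X.weight φ n p.2)
    (fun _ _ => mul_nonneg (weight_nonneg _ _) (weight_nonneg _ _))
    (fun w p _ => ∃ x, X.word (m + n) x = w ∧ X.word m x = p.1 ∧ X.word n (X.shift^[m] x) = p.2)
    ?_ ?_
  · rw [Finset.sum_product, Fintype.card_unit, Nat.cast_one, one_mul] at this
    simpa only [partitionSum, Finset.sum_mul_sum] using this
  · intro w hw h0
    obtain ⟨x, rfl⟩ := exists_word_eq_of_weight_ne_zero h0
    obtain ⟨h1, h2⟩ := h x (by simpa using hw)
    refine ⟨(X.word m x, X.word n (X.shift^[m] x)), by simp [h1, h2], (), ?_, x, rfl, rfl, rfl⟩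
    refine weight_le (mul_nonneg (weight_nonneg _ _) (weight_nonneg _ _)) fun y hy => ?_
    rw [birkhoffSum_add, Real.exp_add]
    dsimp only
    rw [← X.word_mono (Nat.le_add_right m n) hy, ← X.word_shift hy]
    exact mul_le_mul (exp_le_weight hb _ _) (exp_le_weight hb _ _) (Real.exp_pos _).le
      (weight_nonneg _ _)
  · rintro _ _ ⟨p1, p2⟩ _ ⟨x, rfl, hx1, hx2⟩ ⟨y, rfl, hy1, hy2⟩
    refine X.word_eq_iff.mpr fun i hi => ?_
    rcases lt_or_ge i m with him | him
    · exact X.word_eq_iff.mp (hx1.trans hy1.symm) i him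
    · have := X.word_eq_iff.mp (hx2.trans hy2.symm) (i - m) (by omega)
      rwa [iterate_shift_apply, iterate_shift_apply, Nat.sub_add_cancel him] at this

theorem partitionSum_le_ncard_mul {s : ℝ} (hs : ∀ x, φ x ≤ s) (n : ℕ) (S : Set (Fin n → A)) :
    X.partitionSum φ n S ≤ S.ncard * Real.exp (n * s) := by
  classical
  rw [Set.ncard_eq_toFinset_card', ← nsmul_eq_mul]
  refine (Finset.sum_le_card_nsmul _ _ (Real.exp (n * s)) fun w _ => ?_).trans_eq ?_
  · refine weight_le (Real.exp_pos _).le fun x _ => Real.exp_le_exp.mpr ?_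
    refine (Finset.sum_le_sum fun i _ => hs _).trans_eq ?_
    simp
  · congr 2
    ext w
    simp

/-! ### The pressure as growth rate of the partition sums -/

variable (X φ) in
/-- The logarithm of the partition sum over all words of length `n`. -/
noncomputable def logPartitionSum (n : ℕ) : ℝ := Real.log (X.partitionSum φ n Set.univ)

theorem subadditive_logPartitionSum [Nonempty X] (hb : ∀ x, |φ x| ≤ b) :
    Subadditive (logPartitionSum X φ) := by
  intro m n
  rw [logPartitionSum, logPartitionSum, logPartitionSum,
    ← Real.log_mul (partitionSum_pos hb m).ne' (partitionSum_pos hb n).ne']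
  exact Real.log_le_log (partitionSum_pos hb _)
    (partitionSum_le_mul hb _ _ _ fun _ _ => ⟨trivial, trivial⟩)

theorem neg_mul_le_logPartitionSum [Nonempty X] (hb : ∀ x, |φ x| ≤ b) (n : ℕ) :
    -(n * b) ≤ logPartitionSum X φ n := by
  classical
  rw [logPartitionSum, Real.le_log_iff_exp_le (partitionSum_pos hb n)]
  obtain ⟨x⟩ := ‹Nonempty X›
  refine (Real.exp_le_exp.mpr
    (neg_le_of_abs_le (abs_birkhoffSum_le (T := X.shift) hb n x))).trans ?_
  exact exp_le_partitionSum hb n x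

theorem bddBelow_logPartitionSum [Nonempty X] (hb : ∀ x, |φ x| ≤ b) :
    BddBelow (Set.range fun n : ℕ => logPartitionSum X φ n / n) := by
  refine ⟨-b, ?_⟩
  rintro _ ⟨n, rfl⟩
  dsimp only
  have hb0 : 0 ≤ b := by
    obtain ⟨x⟩ := ‹Nonempty X›
    exact (abs_nonneg _).trans (hb x)
  rcases n.eq_zero_or_pos with rfl | hn
  · simpa using hb0
  · rw [le_div_iff₀ (by exact_mod_cast hn)]
    linarith [neg_mul_le_logPartitionSum (X := X) hb n]

/-- `P` is the exponential growth rate of the partition sums. -/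
def IsPressure (X : Subshift A) (φ : X → ℝ) (P : ℝ) : Prop :=
  Tendsto (fun n : ℕ => logPartitionSum X φ n / n) atTop (𝓝 P) ∧
    ∀ n : ℕ, n * P ≤ logPartitionSum X φ n

/-- Fekete's lemma: the limit of a subadditive sequence over `n` is also its infimum, whence the
lower bound for every `n`. -/
theorem exists_isPressure [Nonempty X] (hb : ∀ x, |φ x| ≤ b) : ∃ P, X.IsPressure φ P := by
  have h := subadditive_logPartitionSum (X := X) hb
  have hbdd := bddBelow_logPartitionSum (X := X) hb
  refine ⟨h.lim, h.tendsto_lim hbdd, fun n => ?_⟩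
  rcases n.eq_zero_or_pos with rfl | hn
  · have := neg_mul_le_logPartitionSum (X := X) hb 0
    simpa using this
  · have := h.lim_le_div hbdd hn.ne'
    rw [le_div_iff₀ (by exact_mod_cast hn)] at this
    linarith

theorem IsPressure.exists_le_add {P : ℝ} (hP : X.IsPressure φ P) {ε : ℝ} (hε : 0 < ε) :
    ∃ C, ∀ n : ℕ, logPartitionSum X φ n ≤ C + n * (P + ε) := by
  obtain ⟨N, hN⟩ := eventually_atTop.mp (hP.1.eventually (gt_mem_nhds (lt_add_of_pos_right P hε)))
  refine ⟨∑ i ∈ Finset.range (N + 1), |logPartitionSum X φ i - i * (P + ε)|, fun n => ?_⟩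
  rcases lt_or_ge n (N + 1) with hn | hn
  · have h1 := Finset.single_le_sum
      (f := fun i : ℕ => |logPartitionSum X φ i - i * (P + ε)|) (fun i _ => abs_nonneg _)
      (Finset.mem_range.mpr hn)
    have h2 := le_abs_self (logPartitionSum X φ n - n * (P + ε))
    linarith
  · have h0 : (0 : ℝ) < n := by exact_mod_cast (Nat.succ_pos N).trans_le hn
    have h1 := hN n (by omega)
    rw [div_lt_iff₀ h0] at h1
    have h2 : 0 ≤ ∑ i ∈ Finset.range (N + 1), |logPartitionSum X φ i - i * (P + ε)| :=
      Finset.sum_nonneg fun _ _ => abs_nonneg _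
    linarith

end weight

end Subshift

namespace Subshift

/-! ### Good words with the specification and Bowen properties -/

/-- The words in `G` can be glued with gaps of length `r`, every word of the language splits into
a word in `G` followed by a word in `S`, there are at most `B` words in `S` of each length, and
`φ` has the Bowen property on `G` with constant `K`. -/
structure IsGoodDecomposition {A : Type*} [TopologicalSpace A] (X : Subshift A) (φ : X → ℝ)
    (G S : ∀ n, Set (Fin n → A)) (r B : ℕ) (K : ℝ) : Prop where
  spec : ∀ {m n : ℕ} (x y : X), X.word m x ∈ G m → X.word n y ∈ G n →
    ∃ z, X.word (m + r + n) z ∈ G (m + r + n) ∧ X.word m z = X.word m x ∧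
      X.word n (X.shift^[m + r] z) = X.word n y
  decomp : ∀ (x : X) (n : ℕ), ∃ k j, k + j = n ∧ X.word k x ∈ G k ∧
    X.word j (X.shift^[k] x) ∈ S j
  ncard_le : ∀ n, (S n).ncard ≤ B
  bowen : ∀ {n : ℕ} (x y : X), X.word n x ∈ G n → X.word n y = X.word n x →
    birkhoffSum X.shift φ n y ≤ birkhoffSum X.shift φ n x + K

section
variable {A : Type*} [TopologicalSpace A] {X : Subshift A} {φ : X → ℝ}
  {G S : ∀ n, Set (Fin n → A)} {r B : ℕ} {K b P s : ℝ}

theorem IsGoodDecomposition.weight_le (h : X.IsGoodDecomposition φ G S r B K) {n : ℕ} {x : X}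
    (hx : X.word n x ∈ G n) :
    X.weight φ n (X.word n x) ≤ Real.exp (birkhoffSum X.shift φ n x + K) :=
  Subshift.weight_le (Real.exp_pos _).le fun y hy => Real.exp_le_exp.mpr (h.bowen x y hx hy)

theorem birkhoffSum_gap_le {α : Type*} {T : α → α} {φ : α → ℝ} (hb : ∀ x, |φ x| ≤ b)
    (m r n : ℕ) (z : α) : birkhoffSum T φ m z + birkhoffSum T φ n (T^[m + r] z) ≤
      birkhoffSum T φ (m + r + n) z + r * b := by
  rw [birkhoffSum_add, birkhoffSum_add]
  have := neg_le_of_abs_le (abs_birkhoffSum_le (T := T) hb r (T^[m] z))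
  linarith

variable [Fintype A]

/-- Glue the two words. By the Bowen property both weights may be evaluated along the glued point at
a cost of `K` each, and the gap costs at most `r * b`. -/
theorem IsGoodDecomposition.partitionSum_mul_le (h : X.IsGoodDecomposition φ G S r B K)
    (hb : ∀ x, |φ x| ≤ b) (m n : ℕ) :
    X.partitionSum φ m (G m) * X.partitionSum φ n (G n) ≤
      Real.exp (2 * K + r * b) * X.partitionSum φ (m + r + n) (G (m + r + n)) := by
  classical
  have := sum_le_card_mul_sum_of_rel (τ := Unit)
    ((Finset.univ.filter (· ∈ G m)) ×ˢ (Finset.univ.filter (· ∈ G n)))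
    (Finset.univ.filter (· ∈ G (m + r + n)))
    (fun p => X.weight φ m p.1 * X.weight φ n p.2)
    (fun w => Real.exp (2 * K + r * b) * X.weight φ (m + r + n) w)
    (fun _ _ => mul_nonneg (Real.exp_pos _).le (weight_nonneg _ _))
    (fun p w _ => ∃ z, X.word (m + r + n) z = w ∧ X.word m z = p.1 ∧
      X.word n (X.shift^[m + r] z) = p.2) ?_ ?_
  · rw [Finset.sum_product, Fintype.card_unit, Nat.cast_one, one_mul, ← Finset.mul_sum] at this
    simpa only [partitionSum, Finset.sum_mul_sum] using this
  · rintro ⟨w1, w2⟩ hw h0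
    obtain ⟨x, rfl⟩ := exists_word_eq_of_weight_ne_zero (left_ne_zero_of_mul h0)
    obtain ⟨y, rfl⟩ := exists_word_eq_of_weight_ne_zero (right_ne_zero_of_mul h0)
    simp only [Finset.mem_product, Finset.mem_filter, Finset.mem_univ, true_and] at hw
    obtain ⟨z, hz, hzx, hzy⟩ := h.spec x y hw.1 hw.2
    refine ⟨X.word _ z, by simpa using hz, (), ?_, z, rfl, hzx, hzy⟩
    dsimp only
    rw [← hzx, ← hzy] at hw ⊢
    refine (mul_le_mul (h.weight_le hw.1) (h.weight_le hw.2) (weight_nonneg _ _)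
      (Real.exp_pos _).le).trans ?_
    refine le_trans ?_ (mul_le_mul_of_nonneg_left (exp_le_weight hb _ z) (Real.exp_pos _).le)
    rw [← Real.exp_add, ← Real.exp_add]
    refine Real.exp_le_exp.mpr ?_
    have := birkhoffSum_gap_le (T := X.shift) hb m r n z
    linarith
  · rintro ⟨p1, p2⟩ ⟨q1, q2⟩ w _ ⟨z, rfl, hz1, hz2⟩ ⟨z', hzz, hz1', hz2'⟩
    refine Prod.ext ?_ ?_
    · exact (hz1.symm.trans (X.word_mono (by omega) hzz.symm)).trans hz1'
    · exact (hz2.symm.trans (X.word_shift hzz.symm)).trans hz2'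

theorem IsGoodDecomposition.partitionSum_pow_le (h : X.IsGoodDecomposition φ G S r B K)
    (hb : ∀ x, |φ x| ≤ b) (n k : ℕ) :
    X.partitionSum φ n (G n) ^ (k + 1) ≤ Real.exp (2 * K + r * b) ^ k *
      X.partitionSum φ ((n + r) * k + n) (G ((n + r) * k + n)) := by
  induction k with
  | zero =>
    rw [Nat.mul_zero, Nat.zero_add, pow_zero, one_mul, Nat.zero_add, pow_one]
  | succ k ih =>
    rw [pow_succ', pow_succ (Real.exp _)]
    have h1 := mul_le_mul_of_nonneg_left ih (partitionSum_nonneg (X := X) (φ := φ) n (G n))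
    refine h1.trans ?_
    rw [mul_left_comm, mul_assoc]
    refine mul_le_mul_of_nonneg_left ?_ (pow_nonneg (Real.exp_pos _).le _)
    refine (h.partitionSum_mul_le hb n ((n + r) * k + n)).trans_eq ?_
    have e : n + r + ((n + r) * k + n) = (n + r) * (k + 1) + n := by ring
    rw [e]

/-- Supermultiplicativity bounds a single term from above: the `(k + 1)`-st power of the sum is
controlled by one partition sum of length `(n + r) * k + n`, which grows at rate at most `P`. -/
theorem IsGoodDecomposition.partitionSum_good_le [Nonempty X]
    (h : X.IsGoodDecomposition φ G S r B K)
    (hb : ∀ x, |φ x| ≤ b) (hP : X.IsPressure φ P) (n : ℕ) :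
    X.partitionSum φ n (G n) ≤ Real.exp (2 * K + r * b) * Real.exp ((n + r) * P) := by
  rcases (partitionSum_nonneg (X := X) (φ := φ) n (G n)).eq_or_lt with h0 | h0
  · rw [← h0]
    positivity
  rw [← Real.exp_add, ← Real.log_le_iff_le_exp h0]
  set a := Real.log (X.partitionSum φ n (G n)) with ha
  set c := 2 * K + r * b with hc
  have key : ∀ ε > 0, a ≤ c + (n + r) * P + (n + r) * ε := by
    intro ε hε
    obtain ⟨C, hC⟩ := hP.exists_le_add hε
    have h1 : ∀ k : ℕ, (k + 1) * a ≤ k * c + (C + ((n + r) * k + n) * (P + ε)) := by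
      intro k
      have h2 := h.partitionSum_pow_le hb n k
      have h3 : X.partitionSum φ n (G n) ^ (k + 1) ≤ Real.exp c ^ k *
          X.partitionSum φ ((n + r) * k + n) Set.univ :=
        h2.trans (mul_le_mul_of_nonneg_left (partitionSum_mono (Set.subset_univ _))
          (pow_nonneg (Real.exp_pos _).le _))
      have h4 := Real.log_le_log (pow_pos h0 _) h3
      rw [Real.log_pow, Real.log_mul (pow_pos (Real.exp_pos _) _).ne' (partitionSum_pos hb _).ne',
        Real.log_pow, Real.log_exp, ← ha] at h4
      have h5 := hC ((n + r) * k + n)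
      rw [logPartitionSum] at h5
      push_cast at h4 h5
      linarith
    -- Divide the inequality for `k` by `k` and let `k` tend to infinity.
    by_contra! hcon
    obtain ⟨k, hk⟩ := exists_nat_gt ((C + n * (P + ε) - a) / (a - (c + (n + r) * P + (n + r) * ε)))
    rw [div_lt_iff₀ (by linarith)] at hk
    have := h1 k
    nlinarith
  refine le_of_forall_pos_le_add fun ε hε => ?_
  have h1 : (0 : ℝ) < n + r + 1 := by positivity
  refine (key (ε / (n + r + 1)) (by positivity)).trans ?_
  have : ((n : ℝ) + r) * (ε / (n + r + 1)) ≤ ε := by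
    rw [mul_div_assoc', div_le_iff₀ h1]
    nlinarith
  linarith

/-- The words of length `n` which split into a word in `G` and a word in `S` of length at
least `M`. -/
def tailWords (X : Subshift A) (G S : ∀ n, Set (Fin n → A)) (n M : ℕ) : Set (Fin n → A) :=
  {w | ∃ x, X.word n x = w ∧ ∃ k j, k + j = n ∧ M ≤ j ∧ X.word k x ∈ G k ∧
    X.word j (X.shift^[k] x) ∈ S j}

/-- A suffix of length `j` contributes a factor of order `exp (j * s)` where the full growth would
be `exp (j * P)`. Since `s < P` the losses form a geometric series starting at `j = M`. -/
theorem IsGoodDecomposition.exists_tail_le [Nonempty X] (h : X.IsGoodDecomposition φ G S r B K)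
    (hb : ∀ x, |φ x| ≤ b) (hP : X.IsPressure φ P) (hs : ∀ x, φ x ≤ s) (hsP : s < P) :
    ∃ C > 0, ∀ n M : ℕ, X.partitionSum φ n (X.tailWords G S n M) ≤
      C * Real.exp (s - P) ^ M * Real.exp (n * P) := by
  set q := Real.exp (s - P) with hq
  have hq0 : 0 < q := Real.exp_pos _
  have hq1 : q < 1 := Real.exp_lt_one_iff.mpr (by linarith)
  -- `B + 1` instead of `B` keeps the constant positive.
  set c := Real.exp (2 * K + r * b) * Real.exp (r * P) * (B + 1) with hc
  have hc0 : 0 < c := by positivity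
  refine ⟨c / (1 - q), div_pos hc0 (by linarith), fun n M => ?_⟩
  let U : ℕ → Set (Fin n → A) := fun j => {w | ∃ x, X.word n x = w ∧ ∃ k, k + j = n ∧
    X.word k x ∈ G k ∧ X.word j (X.shift^[k] x) ∈ S j}
  have hU : ∀ j, X.partitionSum φ n (U j) ≤ c * q ^ j * Real.exp (n * P) := by
    intro j
    by_cases hj : j ≤ n
    · obtain ⟨k, rfl⟩ : ∃ k, n = k + j := ⟨n - j, by omega⟩
      have h1 := partitionSum_le_mul (X := X) (φ := φ) hb (U j) (G k) (S j) (by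
        rintro x ⟨y, hy, k', hk', hG, hS⟩
        obtain rfl : k' = k := by omega
        rw [X.word_mono (Nat.le_add_right _ _) hy] at hG
        rw [X.word_shift hy] at hS
        exact ⟨hG, hS⟩)
      refine h1.trans ?_
      have h2 := h.partitionSum_good_le hb hP k
      have h3 : X.partitionSum φ j (S j) ≤ (B + 1) * Real.exp (j * s) := by
        refine (partitionSum_le_ncard_mul hs j (S j)).trans ?_
        refine mul_le_mul_of_nonneg_right ?_ (Real.exp_pos _).le
        have : ((S j).ncard : ℝ) ≤ B := by exact_mod_cast h.ncard_le j
        linarith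
      refine (mul_le_mul h2 h3 (partitionSum_nonneg _ _) (by positivity)).trans_eq ?_
      have e1 : Real.exp ((k + r) * P) = Real.exp (k * P) * Real.exp (r * P) := by
        rw [← Real.exp_add]
        ring_nf
      have e2 : Real.exp (j * s) = q ^ j * Real.exp (j * P) := by
        rw [hq, ← Real.exp_nat_mul, ← Real.exp_add]
        ring_nf
      have e3 : Real.exp (((k + j : ℕ) : ℝ) * P) = Real.exp (k * P) * Real.exp (j * P) := by
        rw [← Real.exp_add]
        push_cast
        ring_nf
      rw [e1, e2, e3, hc]
      ring
    · have : U j = ∅ := by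
        ext w
        simp only [U, Set.mem_ofPred_eq, Set.mem_empty_iff_false, iff_false]
        rintro ⟨x, -, k, hk, -⟩
        omega
      rw [this]
      simp only [partitionSum, Set.mem_empty_iff_false, Finset.filter_false, Finset.sum_empty]
      positivity
  have hsub : X.tailWords G S n M ⊆ ⋃ j ∈ Finset.Ico M (n + 1), U j := by
    rintro w ⟨x, hx, k, j, hkj, hj, hG, hS⟩
    refine Set.mem_iUnion₂.mpr ⟨j, Finset.mem_Ico.mpr ⟨hj, by omega⟩, x, hx, k, hkj, hG, hS⟩
  refine (partitionSum_mono hsub).trans ((partitionSum_iUnion_le _ _).trans ?_)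
  refine (Finset.sum_le_sum fun j _ => hU j).trans ?_
  rw [← Finset.sum_mul, ← Finset.mul_sum]
  refine mul_le_mul_of_nonneg_right ?_ (Real.exp_pos _).le
  rw [div_mul_eq_mul_div, mul_div_assoc]
  exact mul_le_mul_of_nonneg_left (geom_sum_Ico_le_of_lt_one hq0.le hq1) hc0.le

/-- The words of length `n` which belong to `G` after removing a suffix of length at most `M`. -/
def almostGood (X : Subshift A) (G : ∀ n, Set (Fin n → A)) (n M : ℕ) : Set (Fin n → A) :=
  {w | ∃ x, X.word n x = w ∧ ∃ k j, k + j = n ∧ j ≤ M ∧ X.word k x ∈ G k}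

/-- The tail bound with `M = 0`, which covers every word of the language. -/
theorem IsGoodDecomposition.exists_partitionSum_le [Nonempty X]
    (h : X.IsGoodDecomposition φ G S r B K)
    (hb : ∀ x, |φ x| ≤ b) (hP : X.IsPressure φ P) (hs : ∀ x, φ x ≤ s) (hsP : s < P) :
    ∃ C > 0, ∀ n : ℕ, X.partitionSum φ n Set.univ ≤ C * Real.exp (n * P) := by
  obtain ⟨C, hC, hle⟩ := h.exists_tail_le hb hP hs hsP
  refine ⟨C, hC, fun n => ?_⟩
  have h1 := hle n 0
  rw [pow_zero, mul_one] at h1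
  refine le_trans (partitionSum_mono_of_language fun x _ => ?_) h1
  obtain ⟨k, j, hkj, hG, hS⟩ := h.decomp x n
  exact ⟨x, rfl, k, j, hkj, Nat.zero_le _, hG, hS⟩

/-- Most words of a set with large partition sum are good up to a suffix of bounded length. -/
theorem IsGoodDecomposition.exists_almostGood [Nonempty X]
    (h : X.IsGoodDecomposition φ G S r B K)
    (hb : ∀ x, |φ x| ≤ b) (hP : X.IsPressure φ P) (hs : ∀ x, φ x ≤ s) (hsP : s < P)
    {c : ℝ} (hc : 0 < c) :
    ∃ M : ℕ, ∀ (n : ℕ) (D : Set (Fin n → A)), c * Real.exp (n * P) ≤ X.partitionSum φ n D →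
      c / 2 * Real.exp (n * P) ≤ X.partitionSum φ n (D ∩ X.almostGood G n M) := by
  obtain ⟨C, hC, hle⟩ := h.exists_tail_le hb hP hs hsP
  -- Suffixes of length at least `M` then carry at most half of the assumed lower bound.
  obtain ⟨M, hM⟩ := exists_pow_lt_of_lt_one (show 0 < c / 2 / C by positivity)
    (show Real.exp (s - P) < 1 from Real.exp_lt_one_iff.mpr (by linarith))
  refine ⟨M, fun n D hD => ?_⟩
  have h1 : X.partitionSum φ n D ≤ X.partitionSum φ n
      ((D ∩ X.almostGood G n M) ∪ X.tailWords G S n M) := by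
    refine partitionSum_mono_of_language fun x hx => ?_
    obtain ⟨k, j, hkj, hG, hS⟩ := h.decomp x n
    rcases le_total j M with hj | hj
    · exact Or.inl ⟨hx, x, rfl, k, j, hkj, hj, hG⟩
    · exact Or.inr ⟨x, rfl, k, j, hkj, hj, hG, hS⟩
  have h2 := hle n M
  have h3 : C * Real.exp (s - P) ^ M * Real.exp (n * P) ≤ c / 2 * Real.exp (n * P) := by
    refine mul_le_mul_of_nonneg_right ?_ (Real.exp_pos _).le
    rw [lt_div_iff₀ hC] at hM
    linarith
  have h4 := partitionSum_union_le (X := X) (φ := φ) (D ∩ X.almostGood G n M)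
    (X.tailWords G S n M)
  linarith

/-- Two sets of almost good words can be glued. -/
theorem IsGoodDecomposition.partitionSum_glue_le [Nonempty X]
    (h : X.IsGoodDecomposition φ G S r B K) (hb : ∀ x, |φ x| ≤ b) (M : ℕ) :
    ∃ C > 0, ∀ (m n : ℕ) (D : Set (Fin m → A)) (E : Set (Fin n → A))
      (T : Set (Fin (m + r + n) → A)),
      (∀ x y z (j : ℕ), X.word m x ∈ D → X.word n y ∈ E → j ≤ M → j ≤ m →
        X.word (m - M) z = X.word (m - M) x →
        X.word (n - M) (X.shift^[m - j + r] z) = X.word (n - M) y → X.word (m + r + n) z ∈ T) →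
      X.partitionSum φ m (D ∩ X.almostGood G m M) * X.partitionSum φ n (E ∩ X.almostGood G n M) ≤
        C * X.partitionSum φ (m + r + n) T := by
  classical
  have hb0 : 0 ≤ b := by
    obtain ⟨x⟩ := ‹Nonempty X›
    exact (abs_nonneg _).trans (hb x)
  -- The information lost in gluing: the length `j` of the suffix removed from the first word, which
  -- fixes where the second word starts, and the last `M` symbols of both words.
  let τ := Fin (M + 1) × (Fin M → A) × (Fin M → A)
  -- Two Bowen constants, `r * b` for the gap, `2 * M * b` for the two removed suffixes, and another
  -- `2 * M * b` for the end of the glued word, whose length `m + r + n` does not depend on the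
  -- suffixes.
  set E₀ := Real.exp (2 * K + (r + 4 * M) * b) with hE₀
  have hA : Nonempty A := by
    obtain ⟨x⟩ := ‹Nonempty X›
    exact ⟨x.1 0⟩
  refine ⟨Fintype.card τ * E₀, mul_pos (by exact_mod_cast Fintype.card_pos) (Real.exp_pos _),
    fun m n D E T hT => ?_⟩
  obtain ⟨D', hD'⟩ : ∃ D', D' = D ∩ X.almostGood G m M := ⟨_, rfl⟩
  obtain ⟨E', hE'⟩ : ∃ E', E' = E ∩ X.almostGood G n M := ⟨_, rfl⟩
  rw [← hD', ← hE']
  have := sum_le_card_mul_sum_of_rel (τ := τ)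
    ((Finset.univ.filter (· ∈ D')) ×ˢ (Finset.univ.filter (· ∈ E')))
    (Finset.univ.filter (· ∈ T))
    (fun p => X.weight φ m p.1 * X.weight φ n p.2)
    (fun w => E₀ * X.weight φ (m + r + n) w)
    (fun _ _ => mul_nonneg (Real.exp_pos _).le (weight_nonneg _ _))
    (fun p w u => ∃ x y z, X.word m x = p.1 ∧ X.word n y = p.2 ∧ X.word (m + r + n) z = w ∧
      X.word (m - M) z = X.word (m - M) x ∧
      X.word (n - M) (X.shift^[m - u.1 + r] z) = X.word (n - M) y ∧
      (∀ i : Fin M, x.1 (m - M + i) = u.2.1 i) ∧ (∀ i : Fin M, y.1 (n - M + i) = u.2.2 i)) ?_ ?_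
  · rw [Finset.sum_product, ← Finset.mul_sum, ← mul_assoc] at this
    simpa only [partitionSum, Finset.sum_mul_sum] using this
  · rintro ⟨w1, w2⟩ hw -
    simp only [Finset.mem_product, Finset.mem_filter, Finset.mem_univ, true_and, hD', hE'] at hw
    obtain ⟨⟨hD, x, rfl, k, j, rfl, hj, hkG⟩, ⟨hE, y, rfl, k', j', rfl, hj', hkG'⟩⟩ := hw
    obtain ⟨z, hz, hzx, hzy⟩ := h.spec x y hkG hkG'
    have hzx' : X.word (k + j - M) z = X.word (k + j - M) x := X.word_mono (by omega) hzx
    have hzy' : X.word (k' + j' - M) (X.shift^[k + j - j + r] z) = X.word (k' + j' - M) y := by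
      rw [Nat.add_sub_cancel]
      exact X.word_mono (by omega) hzy
    refine ⟨X.word _ z, ?_, (⟨j, by omega⟩, fun i => x.1 (k + j - M + i),
      fun i => y.1 (k' + j' - M + i)), ?_, x, y, z, rfl, rfl, rfl, hzx', hzy', fun _ => rfl,
      fun _ => rfl⟩
    · simpa using hT x y z j hD hE hj (by omega) hzx' hzy'
    · have bound : ∀ (k j : ℕ) (x z : X), j ≤ M → X.word k x ∈ G k → X.word k z = X.word k x →
          X.weight φ (k + j) (X.word (k + j) x) ≤
            Real.exp (birkhoffSum X.shift φ k z + (K + M * b)) := by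
        intro k j x z hj hG hzx
        refine Subshift.weight_le (Real.exp_pos _).le fun x' hx' => Real.exp_le_exp.mpr ?_
        have h1 := X.word_mono (Nat.le_add_right k j) hx'
        have h2 := h.bowen z x' (hzx ▸ hG) (h1.trans hzx.symm)
        rw [birkhoffSum_add]
        have h3 := (le_abs_self _).trans
          (abs_birkhoffSum_le (T := X.shift) hb j (X.shift^[k] x'))
        have h4 : (j : ℝ) * b ≤ M * b :=
          mul_le_mul_of_nonneg_right (by exact_mod_cast hj) hb0
        linarith
      have h1 := bound k j x z hj hkG hzx
      have h2 := bound k' j' y _ hj' hkG' hzy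
      refine (mul_le_mul h1 h2 (weight_nonneg _ _) (Real.exp_pos _).le).trans ?_
      refine le_trans ?_ (mul_le_mul_of_nonneg_left (exp_le_weight hb _ z) (Real.exp_pos _).le)
      rw [hE₀, ← Real.exp_add, ← Real.exp_add]
      refine Real.exp_le_exp.mpr ?_
      have h3 := birkhoffSum_gap_le (T := X.shift) hb k r k' z
      have e : k + j + r + (k' + j') = k + r + k' + (j + j') := by omega
      rw [e, birkhoffSum_add (m := k + r + k')]
      have h4 := neg_le_of_abs_le
        (abs_birkhoffSum_le (T := X.shift) hb (j + j') (X.shift^[k + r + k'] z))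
      have h5 : ((j + j' : ℕ) : ℝ) * b ≤ 2 * M * b := by
        refine mul_le_mul_of_nonneg_right ?_ hb0
        have : ((j + j' : ℕ) : ℝ) ≤ (2 * M : ℕ) := by exact_mod_cast (by omega)
        simpa using this
      linarith
  · rintro ⟨p1, p2⟩ ⟨q1, q2⟩ w ⟨j, s1, s2⟩ ⟨x, y, z, rfl, rfl, hz, hx, hy, hs1, hs2⟩
      ⟨x', y', z', rfl, rfl, hz', hx', hy', hs1', hs2'⟩
    have hzz := hz.trans hz'.symm
    refine Prod.ext ?_ ?_
    · refine X.word_eq_iff.mpr fun i hi => ?_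
      rcases lt_or_ge i (m - M) with hiM | hiM
      · rw [← X.word_eq_iff.mp hx i hiM, ← X.word_eq_iff.mp hx' i hiM]
        exact X.word_eq_iff.mp hzz i (by omega)
      · obtain ⟨i, rfl⟩ : ∃ i', i = m - M + i' := ⟨i - (m - M), by omega⟩
        exact (hs1 ⟨i, by omega⟩).trans (hs1' ⟨i, by omega⟩).symm
    · refine X.word_eq_iff.mpr fun i hi => ?_
      rcases lt_or_ge i (n - M) with hiM | hiM
      · rw [← X.word_eq_iff.mp hy i hiM, ← X.word_eq_iff.mp hy' i hiM,
          iterate_shift_apply, iterate_shift_apply]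
        exact X.word_eq_iff.mp hzz _ (by omega)
      · obtain ⟨i, rfl⟩ : ∃ i', i = n - M + i' := ⟨i - (n - M), by omega⟩
        exact (hs2 ⟨i, by omega⟩).trans (hs2' ⟨i, by omega⟩).symm

end

end Subshift

namespace Subshift

/-! ### Invariant measures of maximal pressure -/

section
variable {A : Type*} [TopologicalSpace A] [MeasurableSpace A] {X : Subshift A} {φ : X → ℝ} {b : ℝ}

theorem measurable_birkhoffSum (hφ : Measurable φ) (n : ℕ) :
    Measurable (birkhoffSum X.shift φ n) :=
  Finset.measurable_sum _ fun i _ => hφ.comp (X.measurable_shift.iterate i)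

theorem integrable_birkhoffSum (hφ : Measurable φ) (hb : ∀ x, |φ x| ≤ b) (ν : Measure X)
    [IsFiniteMeasure ν] (n : ℕ) : Integrable (birkhoffSum X.shift φ n) ν :=
  Integrable.of_bound (measurable_birkhoffSum hφ n).aestronglyMeasurable (n * b)
    (ae_of_all _ fun x => abs_birkhoffSum_le hb n x)

theorem integrable_of_abs_le (hφ : Measurable φ) (hb : ∀ x, |φ x| ≤ b) (ν : Measure X)
    [IsFiniteMeasure ν] : Integrable φ ν :=
  Integrable.of_bound hφ.aestronglyMeasurable b (ae_of_all _ hb)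

theorem integral_birkhoffSum (hφ : Measurable φ) (hb : ∀ x, |φ x| ≤ b) (ν : Measure X)
    [IsFiniteMeasure ν] (hν : MeasurePreserving X.shift ν ν) (n : ℕ) :
    ∫ x, birkhoffSum X.shift φ n x ∂ν = n * ∫ x, φ x ∂ν := by
  simp only [birkhoffSum]
  have h1 : ∀ k, ∫ x, φ (X.shift^[k] x) ∂ν = ∫ x, φ x ∂ν := fun k => by
    rw [← integral_map (hν.iterate k).aemeasurable hφ.aestronglyMeasurable,
      (hν.iterate k).map_eq]
  rw [integral_finsetSum _ fun k _ => ?_]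
  · simp [h1]
  · exact Integrable.of_bound (hφ.comp (X.measurable_shift.iterate k)).aestronglyMeasurable b
      (ae_of_all _ fun x => hb _)

variable [Fintype A] [MeasurableSingletonClass A]

theorem integral_comp_word (ν : Measure X) [IsFiniteMeasure ν] (n : ℕ) (g : (Fin n → A) → ℝ) :
    Integrable (fun x => g (X.word n x)) ν ∧
      ∫ x, g (X.word n x) ∂ν = ∑ w, ν.real (X.word n ⁻¹' {w}) * g w := by
  have hm := X.measurable_word n
  have hg : Integrable g (ν.map (X.word n)) := Integrable.of_finite
  refine ⟨hg.comp_measurable hm, ?_⟩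
  rw [← integral_map hm.aemeasurable hg.aestronglyMeasurable, integral_fintype hg]
  refine Finset.sum_congr rfl fun w _ => ?_
  rw [map_measureReal_apply hm (measurableSet_singleton w), smul_eq_mul]

/-- The Gibbs inequality for the words of length `n`. -/
theorem shannonEntropy_word_add_integral_le (hφ : Measurable φ) (hb : ∀ x, |φ x| ≤ b)
    (ν : Measure X) [IsProbabilityMeasure ν] (n : ℕ)
    (a : (Fin n → A) → ℝ) (ha : ∀ w, 0 < a w) :
    shannonEntropy ν (X.word n) + ∫ x, birkhoffSum X.shift φ n x ∂ν ≤
      ∑ w, ν.real (X.word n ⁻¹' {w}) * Real.log (a w) + ∑ w, X.weight φ n w / a w - 1 := by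
  obtain ⟨hi, he⟩ := integral_comp_word (X := X) ν n fun w => Real.log (X.weight φ n w)
  have h1 : ∫ x, birkhoffSum X.shift φ n x ∂ν ≤
      ∑ w, ν.real (X.word n ⁻¹' {w}) * Real.log (X.weight φ n w) := by
    rw [← he]
    refine integral_mono (integrable_birkhoffSum hφ hb ν n) hi fun x => ?_
    exact (Real.le_log_iff_exp_le ((Real.exp_pos _).trans_le (exp_le_weight hb n x))).mpr
      (exp_le_weight hb n x)
  have h2 : ∀ w, Real.negMulLog (ν.real (X.word n ⁻¹' {w})) ≤
      -(ν.real (X.word n ⁻¹' {w}) * Real.log (X.weight φ n w)) +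
      ν.real (X.word n ⁻¹' {w}) * Real.log (a w) + X.weight φ n w / a w -
      ν.real (X.word n ⁻¹' {w}) := by
    intro w
    by_cases h0 : X.weight φ n w = 0
    · have : X.word n ⁻¹' {w} = ∅ := by
        ext x
        simp only [Set.mem_preimage, Set.mem_singleton_iff, Set.mem_empty_iff_false, iff_false]
        rintro rfl
        exact ((Real.exp_pos _).trans_le (exp_le_weight hb n x)).ne' h0
      rw [this, h0]
      simp
    · have hw : 0 < X.weight φ n w := (weight_nonneg n w).lt_of_ne (Ne.symm h0)
      have := negMulLog_le_of_weights (p := ν.real (X.word n ⁻¹' {w}))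
        (q := X.weight φ n w / a w) measureReal_nonneg (div_pos hw (ha w)).le
        (fun e => absurd e (div_pos hw (ha w)).ne')
      rw [Real.log_div h0 (ha w).ne'] at this
      linarith
  have h3 := Finset.sum_le_sum fun w (_ : w ∈ Finset.univ) => h2 w
  rw [Finset.sum_sub_distrib, Finset.sum_add_distrib, Finset.sum_add_distrib,
    Finset.sum_neg_distrib, sum_measureReal_fiber ν (X.measurable_word n)] at h3
  have h4 : shannonEntropy ν (X.word n) =
    ∑ w, Real.negMulLog (ν.real (X.word n ⁻¹' {w})) := rfl
  linarith

/-- Gibbs' inequality against the normalized weights. -/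
theorem shannonEntropy_word_add_integral_le_log (hφ : Measurable φ) (hb : ∀ x, |φ x| ≤ b)
    (ν : Measure X) [IsProbabilityMeasure ν] (n : ℕ) :
    shannonEntropy ν (X.word n) + ∫ x, birkhoffSum X.shift φ n x ∂ν ≤ logPartitionSum X φ n := by
  have hne : Nonempty X := nonempty_of_isProbabilityMeasure ν
  have hZ := partitionSum_pos (X := X) hb n
  have h := shannonEntropy_word_add_integral_le hφ hb ν n
    (fun _ => X.partitionSum φ n Set.univ) (fun _ => hZ)
  rw [← Finset.sum_mul, sum_measureReal_fiber ν (X.measurable_word n), ← Finset.sum_div,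
    sum_weight_eq, div_self hZ.ne'] at h
  rw [logPartitionSum]
  linarith

/-- `ν` is an invariant probability measure whose words have maximal pressure. -/
structure HasMaximalPressure (X : Subshift A) (φ : X → ℝ) (P : ℝ) (ν : Measure X) : Prop where
  isProbabilityMeasure : IsProbabilityMeasure ν
  measurePreserving : MeasurePreserving X.shift ν ν
  le : ∀ n : ℕ, n * P ≤ shannonEntropy ν (X.word n) + n * ∫ x, φ x ∂ν

variable {P C : ℝ}

/-- Sets of words that carry a definite part of a measure of maximal pressure have partition sums
of maximal order. -/
theorem HasMaximalPressure.exists_le_partitionSum (hφ : Measurable φ) (hb : ∀ x, |φ x| ≤ b)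
    (hC : ∀ n : ℕ, X.partitionSum φ n Set.univ ≤ C * Real.exp (n * P))
    {ν : Measure X} (hν : X.HasMaximalPressure φ P ν) {t : ℝ} (ht : 0 < t) :
    ∃ c > 0, ∀ (n : ℕ) (D : Set (Fin n → A)), t ≤ ν.real (X.word n ⁻¹' D) →
      c * Real.exp (n * P) ≤ X.partitionSum φ n D := by
  classical
  have := hν.isProbabilityMeasure
  have hne : Nonempty X := nonempty_of_isProbabilityMeasure ν
  have hC0 : 0 ≤ C := by
    have h1 := (partitionSum_pos (X := X) hb 0).le.trans (hC 0)
    simpa using h1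
  -- The comparison weights are lowered by the factor `δ` on `D`. As `D` has mass at least `t`, this
  -- lowers the mean logarithm by at least `C + 1`, more than the `C` contributed by all words
  -- together, so the words of `D` must make up the difference.
  set δ := Real.exp (-((C + 1) / t)) with hδ
  have hδ0 : 0 < δ := Real.exp_pos _
  refine ⟨δ, hδ0, fun n D hD => ?_⟩
  set E := Real.exp (n * P) with hE
  have hE0 : 0 < E := Real.exp_pos _
  set p := fun w => ν.real (X.word n ⁻¹' {w}) with hp
  have hp1 : ∑ w, p w = 1 := sum_measureReal_fiber ν (X.measurable_word n)
  have h1 := shannonEntropy_word_add_integral_le hφ hb ν n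
    (fun w => (if w ∈ D then δ else 1) * E)
    (fun w => mul_pos (by split_ifs <;> [exact hδ0; exact one_pos]) hE0)
  rw [integral_birkhoffSum hφ hb ν hν.measurePreserving] at h1
  have h2 : ∑ w, p w * Real.log ((if w ∈ D then δ else 1) * E) =
      n * P - (C + 1) / t * ν.real (X.word n ⁻¹' D) := by
    have e1 : ∀ w, p w * Real.log ((if w ∈ D then δ else 1) * E) =
        p w * (n * P) - (C + 1) / t * (if w ∈ D then p w else 0) := by
      intro w
      split_ifs
      · rw [Real.log_mul hδ0.ne' hE0.ne', hδ, hE, Real.log_exp, Real.log_exp]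
        ring
      · rw [one_mul, hE, Real.log_exp]
        ring
    have e2 : ν.real (X.word n ⁻¹' D) = ∑ w, if w ∈ D then p w else 0 := by
      have := sum_measureReal_fiber_comp ν (X.measurable_word n) (fun w => decide (w ∈ D)) true
      rw [Finset.sum_filter] at this
      simp only [decide_eq_true_eq] at this
      rw [← this]
      congr 1
      ext x
      simp
    rw [Finset.sum_congr rfl fun w _ => e1 w, Finset.sum_sub_distrib, ← Finset.sum_mul, hp1,
      ← Finset.mul_sum, e2, one_mul]
  have h3 : ∑ w, X.weight φ n w / ((if w ∈ D then δ else 1) * E) ≤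
      X.partitionSum φ n D / (δ * E) + C := by
    have e3 : X.partitionSum φ n Set.univ / E ≤ C := (div_le_iff₀ hE0).mpr (hC n)
    refine le_trans ?_ (add_le_add_right e3 _)
    rw [← sum_weight_eq, partitionSum, Finset.sum_filter, Finset.sum_div, Finset.sum_div,
      ← Finset.sum_add_distrib]
    refine Finset.sum_le_sum fun w _ => ?_
    have hw := weight_nonneg (X := X) (φ := φ) n w
    split_ifs
    · exact le_add_of_nonneg_right (by positivity)
    · simp
  have h4 := hν.le n
  have h5 : C + 1 ≤ (C + 1) / t * ν.real (X.word n ⁻¹' D) := by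
    rw [div_mul_eq_mul_div, le_div_iff₀ ht]
    exact mul_le_mul_of_nonneg_left hD (by linarith)
  have h6 : 1 ≤ X.partitionSum φ n D / (δ * E) := by
    rw [h2] at h1
    linarith
  rwa [one_le_div (by positivity)] at h6

end

/-- Mixtures of measures of maximal pressure have maximal pressure. -/
theorem HasMaximalPressure.half_add_half {A : Type*} [TopologicalSpace A] [MeasurableSpace A]
    [Fintype A] {X : Subshift A} {φ : X → ℝ} {b P : ℝ} (hφ : Measurable φ)
    (hb : ∀ x, |φ x| ≤ b) {μ ν : Measure X} (hμ : X.HasMaximalPressure φ P μ)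
    (hν : X.HasMaximalPressure φ P ν) :
    X.HasMaximalPressure φ P ((2⁻¹ : ENNReal) • μ + (2⁻¹ : ENNReal) • ν) := by
  have h1 := hμ.isProbabilityMeasure
  have h2 := hν.isProbabilityMeasure
  have hreal : ∀ s, ((2⁻¹ : ENNReal) • μ + (2⁻¹ : ENNReal) • ν).real s =
      2⁻¹ * μ.real s + 2⁻¹ * ν.real s := fun s => by
    rw [measureReal_add_apply (by simp [ENNReal.mul_eq_top]) (by simp [ENNReal.mul_eq_top]),
      measureReal_ennreal_smul_apply, measureReal_ennreal_smul_apply]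
    simp
  refine ⟨⟨?_⟩, ⟨X.measurable_shift, ?_⟩, fun n => ?_⟩
  · simp [ENNReal.inv_two_add_inv_two]
  · rw [Measure.map_add _ _ X.measurable_shift, Measure.map_smul, Measure.map_smul,
      hμ.measurePreserving.map_eq, hν.measurePreserving.map_eq]
  · have hint : ∫ x, φ x ∂((2⁻¹ : ENNReal) • μ + (2⁻¹ : ENNReal) • ν) =
        2⁻¹ * ∫ x, φ x ∂μ + 2⁻¹ * ∫ x, φ x ∂ν := by
      rw [integral_add_measure ((integrable_of_abs_le hφ hb μ).smul_measure (by simp))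
        ((integrable_of_abs_le hφ hb ν).smul_measure (by simp)), integral_smul_measure,
        integral_smul_measure]
      simp
    have hH := sum_shannonEntropy_le (Finset.univ : Finset Bool) (fun _ => (2⁻¹ : ℝ))
      (fun _ _ => by norm_num) (by norm_num) ((2⁻¹ : ENNReal) • μ + (2⁻¹ : ENNReal) • ν)
      (X.word n) (fun i => if i then μ else ν) (fun _ => X.word n)
      (fun s => by rw [hreal]; simp)
    simp only [Fintype.sum_bool, if_true, Bool.false_eq_true, if_false] at hH
    have := hμ.le n
    have := hν.le n
    rw [hint]
    linarith

end Subshift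

/-! ### Ergodicity and uniqueness of measures of maximal pressure -/

open Classical in
/-- The number of visits to `B` between the times `a` and `a + L`. -/
noncomputable def visits {Ω : Type*} (T : Ω → Ω) (B : Set Ω) (a L : ℕ) (x : Ω) : Finset ℕ :=
  (Finset.range L).filter fun k => T^[a + k] x ∈ B

theorem mem_visits {Ω : Type*} {T : Ω → Ω} {B : Set Ω} {a L : ℕ} {x : Ω} {k : ℕ} :
    k ∈ visits T B a L x ↔ k < L ∧ T^[a + k] x ∈ B := by
  classical
  simp [visits]

/-- Markov's inequality with threshold `L / 4`: by invariance the expected number of visits is `L *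
ν.real B`. No ergodic theorem is needed. -/
theorem measureReal_le_visits_le {Ω : Type*} [MeasurableSpace Ω] {T : Ω → Ω} {ν : Measure Ω}
    [IsFiniteMeasure ν] (hT : MeasurePreserving T ν ν) {B : Set Ω} (hB : MeasurableSet B)
    (a : ℕ) {L : ℕ} (hL : 0 < L) :
    ν.real {x | L ≤ 4 * (visits T B a L x).card} ≤ 4 * ν.real B := by
  classical
  have hL0 : (0 : ℝ) < L := by exact_mod_cast hL
  let g : Ω → ℝ := fun x => ∑ k ∈ Finset.range L, (T^[a + k] ⁻¹' B).indicator 1 x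
  have hm : ∀ k, MeasurableSet (T^[a + k] ⁻¹' B) := fun k => (hT.measurable.iterate _) hB
  have hg : ∀ x, ((visits T B a L x).card : ℝ) = g x := by
    intro x
    rw [visits, Finset.card_filter]
    push_cast
    refine Finset.sum_congr rfl fun k _ => ?_
    simp [Set.indicator_apply]
  have hi : ∀ k, Integrable ((T^[a + k] ⁻¹' B).indicator (1 : Ω → ℝ)) ν := fun k =>
    (integrable_const (1 : ℝ)).indicator (hm k)
  have hint : ∫ x, g x ∂ν = L * ν.real B := by
    rw [integral_finsetSum _ fun k _ => hi k]
    have : ∀ k, ∫ x, (T^[a + k] ⁻¹' B).indicator (1 : Ω → ℝ) x ∂ν = ν.real B := fun k => by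
      rw [integral_indicator_one (hm k),
        (hT.iterate (a + k)).measureReal_preimage hB.nullMeasurableSet]
    simp [this]
  have hmk := mul_meas_ge_le_integral_of_nonneg (μ := ν) (f := g)
    (ae_of_all _ fun x => Finset.sum_nonneg fun k _ =>
      Set.indicator_nonneg (fun _ _ => zero_le_one) _)
    (integrable_finsetSum _ fun k _ => hi k) (L / 4)
  rw [hint] at hmk
  have hset : {x | L ≤ 4 * (visits T B a L x).card} = {x | (L : ℝ) / 4 ≤ g x} := by
    ext x
    simp only [Set.mem_ofPred_eq]
    rw [← hg, div_le_iff₀ (by norm_num), mul_comm]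
    exact_mod_cast Iff.rfl
  rw [hset]
  have h3 : (L : ℝ) * (ν.real {x | (L : ℝ) / 4 ≤ g x}) ≤ L * (4 * ν.real B) := by linarith
  exact le_of_mul_le_mul_left h3 hL0

theorem iterate_mem_iff_of_preimage_eq {Ω : Type*} {T : Ω → Ω} {E : Set Ω} (h : T ⁻¹' E = E)
    (k : ℕ) (x : Ω) : T^[k] x ∈ E ↔ x ∈ E := by
  induction k generalizing x with
  | zero => rfl
  | succ k ih =>
    rw [Function.iterate_succ_apply, ih]
    exact iff_of_eq (congrArg (x ∈ ·) h)

namespace Subshift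

variable {A : Type*} [TopologicalSpace A] {X : Subshift A}

/-- The points of `E` whose frequency of visits to `E \ F` is small in the first blocks
of length `L`. -/
def typicalPoints (X : Subshift A) (E F : Set X) (L i : ℕ) : Set X :=
  {x | x ∈ E ∧ ∀ k ≤ i, 4 * (visits X.shift (E \ F) (k * L) L x).card < L}

/-- The points that follow a typical point of `E` up to time `(i + 1) L` and then, after a gap,
a typical point of the complement of `E`. -/
def switchPoints (X : Subshift A) (E F : Set X) (r M L Q i : ℕ) : Set X :=
  {z | ∃ x ∈ X.typicalPoints E F L i, ∃ y ∈ X.typicalPoints Eᶜ Fᶜ L 0, ∃ j ≤ M,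
    j ≤ (i + 1) * L ∧ X.word ((i + 1) * L - M) z = X.word ((i + 1) * L - M) x ∧
    X.word ((Q - i) * L - M) (X.shift^[(i + 1) * L - j + r] z) = X.word ((Q - i) * L - M) y}

/-- The switching time can be recovered from the word. -/
theorem disjoint_switchPoints {E F : Set X} (hE : X.shift ⁻¹' E = E) {l r M L Q : ℕ}
    (hF : X.IsCylinderSet l F) (hL : 2 * (2 * M + l + r) < L) {i i' : ℕ} (hii' : i < i')
    (hi' : i' < Q) {z z' : X} (hz : z ∈ X.switchPoints E F r M L Q i)
    (hz' : z' ∈ X.switchPoints E F r M L Q i')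
    (hzz' : X.word ((Q + 1) * L + r) z = X.word ((Q + 1) * L + r) z') : False := by
  classical
  obtain ⟨-, -, y, ⟨hyE, hy⟩, j, hj, hjm, -, hzy⟩ := hz
  obtain ⟨x, ⟨hxE, hx⟩, -, -, -, -, -, hzx, -⟩ := hz'
  have hx' := hx (i + 1) hii'
  have hy' := hy 0 le_rfl
  rw [Nat.zero_mul] at hy'
  set a := (i + 1) * L with ha
  -- In the block after the earlier switch, `z` already follows `y` outside `E`, while `z'`, with
  -- the same symbols, still follows `x` in `E`. Whichever answer `F` gives at time `a + k` is wrong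
  -- for one of them. The window leaves room for the gap, the removed suffixes and the `l` symbols
  -- read by `F`.
  have hcov : Finset.Ico r (L - 2 * M - l) ⊆ visits X.shift (E \ F) a L x ∪
      (visits X.shift (Eᶜ \ Fᶜ) 0 L y).image fun k => k + r - j := by
    intro k hk
    obtain ⟨hk1, hk2⟩ := Finset.mem_Ico.mp hk
    rw [Finset.mem_union]
    have hai' : a + L ≤ (i' + 1) * L := by
      have := Nat.mul_le_mul_right L (show i + 2 ≤ i' + 1 by omega)
      rw [ha]
      linarith [show (i + 2) * L = (i + 1) * L + L by ring]
    have haQ : (i' + 1) * L ≤ (Q + 1) * L := Nat.mul_le_mul_right L (by omega)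
    have hQi : L ≤ (Q - i) * L := Nat.le_mul_of_pos_left L (by omega)
    by_cases hkF : X.shift^[a + k] z ∈ F
    · right
      refine Finset.mem_image.mpr ⟨k + j - r, ?_, by omega⟩
      refine mem_visits.mpr ⟨by omega, ?_⟩
      refine ⟨fun h => hyE ((iterate_mem_iff_of_preimage_eq hE _ _).mp h), fun h => h ?_⟩
      refine hF _ _ ?_ hkF
      have h1 : X.word (k + j - r + l) (X.shift^[a - j + r] z) = X.word (k + j - r + l) y :=
        X.word_mono (by omega) hzy
      have h2 := X.word_shift h1
      rw [← Function.iterate_add_apply, show k + j - r + (a - j + r) = a + k by omega] at h2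
      rw [Nat.zero_add]
      exact h2
    · left
      refine mem_visits.mpr ⟨by omega, ?_⟩
      refine ⟨(iterate_mem_iff_of_preimage_eq hE _ _).mpr hxE, fun h => hkF ?_⟩
      refine hF _ _ ?_ h
      have h1 : X.word (a + k + l) x = X.word (a + k + l) z :=
        (X.word_mono (by omega) hzx.symm).trans (X.word_mono (by omega) hzz'.symm)
      exact X.word_shift h1
  -- Each visit set has fewer than `L / 4` elements, but the window has `L - 2 * M - l - r`, which
  -- is more than `L / 2`.
  have h1 := (Finset.card_le_card hcov).trans (Finset.card_union_le _ _)
  have h2 := h1.trans (Nat.add_le_add_left Finset.card_image_le _)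
  rw [Nat.card_Ico] at h2
  omega

variable [MeasurableSpace A]

/-- Each of the `i + 1` blocks excludes at most `4 * ν.real (E \ F)`. The typical points are
enlarged to a union of cylinders because the lower bounds on partition sums concern sets of words.
-/
theorem measureReal_typicalPoints {ν : Measure X} [IsProbabilityMeasure ν]
    (hν : MeasurePreserving X.shift ν ν) {E F : Set X} (hE : MeasurableSet E)
    (hF : MeasurableSet F) {L : ℕ} (hL : 0 < L) (n i : ℕ) :
    ν.real E ≤ ν.real (X.word n ⁻¹' (X.word n '' X.typicalPoints E F L i)) +
      (i + 1) * (4 * ν.real (E \ F)) := by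
  have hsub : E ⊆ (X.word n ⁻¹' (X.word n '' X.typicalPoints E F L i)) ∪
      ⋃ k ∈ Finset.range (i + 1),
        {x | L ≤ 4 * (visits X.shift (E \ F) (k * L) L x).card} := by
    intro x hx
    by_cases h : ∀ k ≤ i, 4 * (visits X.shift (E \ F) (k * L) L x).card < L
    · exact Or.inl ⟨x, ⟨hx, h⟩, rfl⟩
    · push Not at h
      obtain ⟨k, hk, hle⟩ := h
      exact Or.inr (Set.mem_iUnion₂.mpr ⟨k, Finset.mem_range.mpr (by omega), hle⟩)
  refine (measureReal_mono hsub).trans ((measureReal_union_le _ _).trans ?_)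
  refine add_le_add_right ((measureReal_biUnion_finset_le _ _).trans ?_) _
  refine (Finset.sum_le_sum fun k _ =>
    measureReal_le_visits_le hν (hE.diff hF) (k * L) hL).trans_eq ?_
  simp

variable [Fintype A] [MeasurableSingletonClass A] {φ : X → ℝ} {G S : ∀ n, Set (Fin n → A)} {r B : ℕ} {K b P s : ℝ}

/-- Measures of maximal pressure are ergodic. -/
theorem HasMaximalPressure.measure_eq_zero_or (h : X.IsGoodDecomposition φ G S r B K)
    (hφ : Measurable φ) (hb : ∀ x, |φ x| ≤ b) (hP : X.IsPressure φ P) (hs : ∀ x, φ x ≤ s)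
    (hsP : s < P) {ν : Measure X} (hν : X.HasMaximalPressure φ P ν) {E : Set X}
    (hE : MeasurableSet E) (hinv : X.shift ⁻¹' E = E) : ν.real E = 0 ∨ ν.real Eᶜ = 0 := by
  have hprob := hν.isProbabilityMeasure
  have hne : Nonempty X := nonempty_of_isProbabilityMeasure ν
  by_contra! hcon
  have hE1 : 0 < ν.real E := measureReal_nonneg.lt_of_ne hcon.1.symm
  have hE2 : 0 < ν.real Eᶜ := measureReal_nonneg.lt_of_ne hcon.2.symm
  set t := min (ν.real E) (ν.real Eᶜ) / 2 with ht
  have ht0 : 0 < t := half_pos (lt_min hE1 hE2)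
  have htE : 2 * t ≤ ν.real E := by
    have := min_le_left (ν.real E) (ν.real Eᶜ)
    linarith
  have htE' : 2 * t ≤ ν.real Eᶜ := by
    have := min_le_right (ν.real E) (ν.real Eᶜ)
    linarith
  obtain ⟨C, hC0, hC⟩ := h.exists_partitionSum_le hb hP hs hsP
  obtain ⟨c, hc0, hc⟩ := hν.exists_le_partitionSum hφ hb hC ht0
  obtain ⟨M, hM⟩ := h.exists_almostGood hb hP hs hsP hc0
  obtain ⟨C', hC'0, hC'⟩ := h.partitionSum_glue_le hb M
  -- The number of switching times depends only on constants found before `E` is approximated. Hence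
  -- the error in choosing `F` can be taken small relative to `Q`, and the block length `L` can be
  -- adapted to the length `l` read by `F`.
  obtain ⟨Q, hQ⟩ := exists_nat_gt (C' * (C * Real.exp (r * P)) / (c / 2 * (c / 2)))
  rw [div_lt_iff₀ (by positivity)] at hQ
  have hε : 0 < t / (4 * (Q + 1)) := by positivity
  obtain ⟨l, F, hF, hFE⟩ := X.exists_isCylinderSet_symmDiff_lt ν hE (ENNReal.ofReal_pos.mpr hε)
  have hFE' : ν.real (symmDiff F E) ≤ t / (4 * (Q + 1)) :=
    ENNReal.toReal_le_of_le_ofReal hε.le hFE.le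
  have hEF : ν.real (E \ F) ≤ t / (4 * (Q + 1)) :=
    (measureReal_mono fun x hx => Or.inr hx).trans hFE'
  have hEF' : ν.real (Eᶜ \ Fᶜ) ≤ t / (4 * (Q + 1)) := by
    refine (measureReal_mono fun x hx => Or.inl ⟨?_, hx.1⟩).trans hFE'
    simpa using hx.2
  set L := 2 * (2 * M + l + r) + 1 with hL
  have hL0 : 0 < L := by omega
  have hsmall : ∀ i < Q, ∀ {u : ℝ}, u ≤ t / (4 * (Q + 1)) → (i + 1) * (4 * u) ≤ t := by
    intro i hi u hu
    have h1 : (i : ℝ) + 1 ≤ Q + 1 := by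
      have : (i : ℝ) < Q := by exact_mod_cast hi
      linarith
    calc (i + 1) * (4 * u) ≤ (i + 1) * (4 * (t / (4 * (Q + 1)))) := by gcongr
      _ ≤ (Q + 1) * (4 * (t / (4 * (Q + 1)))) := by gcongr
      _ = t := by field_simp
  set N := (Q + 1) * L + r with hN
  let T : ∀ n, ℕ → Set (Fin n → A) := fun n i => X.word n '' X.switchPoints E F r M L Q i
  -- For every switching time the glued words have the same length `N` and carry a share of order
  -- `exp (N * P)`, with a constant independent of `i`.
  have hterm : ∀ i ∈ Finset.range Q, c / 2 * (c / 2) * Real.exp (((Q + 1) * L : ℕ) * P) ≤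
      C' * X.partitionSum φ N (T N i) := by
    intro i hi
    have hiQ := Finset.mem_range.mp hi
    set m := (i + 1) * L with hm
    set n := (Q - i) * L with hn
    have hmn : m + n = (Q + 1) * L := by
      rw [hm, hn, ← Nat.add_mul]
      congr 1
      omega
    have h1 : c * Real.exp (m * P) ≤
        X.partitionSum φ m (X.word m '' X.typicalPoints E F L i) := by
      refine hc m _ ?_
      have h2 := measureReal_typicalPoints hν.measurePreserving hE hF.measurableSet hL0 m i
      have h3 := hsmall i hiQ hEF
      linarith
    have h2 : c * Real.exp (n * P) ≤
        X.partitionSum φ n (X.word n '' X.typicalPoints Eᶜ Fᶜ L 0) := by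
      refine hc n _ ?_
      have h2 := measureReal_typicalPoints hν.measurePreserving hE.compl
        hF.measurableSet.compl hL0 n 0
      have h3 := hsmall 0 (by omega) hEF'
      push_cast at h2 h3
      linarith
    have h3 := hM m _ h1
    have h4 := hM n _ h2
    have h5 := hC' m n (X.word m '' X.typicalPoints E F L i)
      (X.word n '' X.typicalPoints Eᶜ Fᶜ L 0) (T (m + r + n) i) (by
        rintro x y z j ⟨x', hx', hxx'⟩ ⟨y', hy', hyy'⟩ hj hjm hzx hzy
        refine ⟨z, ⟨x', hx', y', hy', j, hj, hjm, hzx.trans ?_, hzy.trans ?_⟩, rfl⟩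
        · exact X.word_mono (Nat.sub_le _ _) hxx'.symm
        · exact X.word_mono (Nat.sub_le _ _) hyy'.symm)
    have h6 := (mul_le_mul h3 h4 (by positivity) (partitionSum_nonneg _ _)).trans h5
    have e : m + r + n = N := by omega
    rw [e] at h6
    refine le_trans (le_of_eq ?_) h6
    rw [← hmn, Nat.cast_add, add_mul, Real.exp_add]
    ring
  have hsum := Finset.sum_le_sum hterm
  rw [Finset.sum_const, Finset.card_range, nsmul_eq_mul, ← Finset.mul_sum] at hsum
  have hdisj := sum_partitionSum_le_of_disjoint (X := X) (φ := φ) (Finset.range Q) (T N) (by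
    rintro i hi i' hi' x ⟨z, hz, hzx⟩ ⟨z', hz', hzx'⟩
    have hzz := hzx.trans hzx'.symm
    rcases lt_trichotomy i i' with hlt | heq | hgt
    · exact (disjoint_switchPoints hinv hF (by omega) hlt (Finset.mem_range.mp hi')
        hz hz' hzz).elim
    · exact heq
    · exact (disjoint_switchPoints hinv hF (by omega) hgt (Finset.mem_range.mp hi)
        hz' hz hzz.symm).elim)
  have hfin := hsum.trans (mul_le_mul_of_nonneg_left (hdisj.trans (hC N)) hC'0.le)
  have hexp : Real.exp (N * P) = Real.exp (r * P) * Real.exp (((Q + 1) * L : ℕ) * P) := by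
    rw [hN, Nat.cast_add, add_mul, Real.exp_add]
    ring
  rw [hexp] at hfin
  have hpos := Real.exp_pos (((Q + 1) * L : ℕ) * P)
  have : Q * (c / 2 * (c / 2)) ≤ C' * (C * Real.exp (r * P)) := by
    refine le_of_mul_le_mul_right ?_ hpos
    linarith
  linarith

/-- There is at most one measure of maximal pressure. -/
theorem HasMaximalPressure.eq (h : X.IsGoodDecomposition φ G S r B K)
    (hφ : Measurable φ) (hb : ∀ x, |φ x| ≤ b) (hP : X.IsPressure φ P) (hs : ∀ x, φ x ≤ s)
    (hsP : s < P) {μ ν : Measure X} (hμ : X.HasMaximalPressure φ P μ)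
    (hν : X.HasMaximalPressure φ P ν) : μ = ν := by
  have hmid := hμ.half_add_half hφ hb hν
  set m := (2⁻¹ : ENNReal) • μ + (2⁻¹ : ENNReal) • ν with hm
  have := hmid.isProbabilityMeasure
  have herg : Ergodic X.shift m := by
    refine ⟨hmid.measurePreserving, ⟨fun E hE hinv => ?_⟩⟩
    rw [eventuallyConst_set']
    rcases hmid.measure_eq_zero_or h hφ hb hP hs hsP hE hinv with h0 | h0
    · left
      exact ae_eq_empty.mpr ((measureReal_eq_zero_iff).mp h0)
    · right
      exact ae_eq_univ.mpr ((measureReal_eq_zero_iff).mp h0)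
  -- Ergodic measures are extreme among invariant probability measures, so the segment from `μ` to
  -- `ν` through its midpoint `m` is degenerate.
  have hext := mem_extremePoints.mp (Ergodic.iff_mem_extremePoints.mp herg)
  have := hext.2 μ ⟨hμ.measurePreserving, hμ.isProbabilityMeasure⟩ ν
    ⟨hν.measurePreserving, hν.isProbabilityMeasure⟩
    ⟨2⁻¹, 2⁻¹, by simp, by simp, ENNReal.inv_two_add_inv_two, rfl⟩
  exact this.1.trans this.2.symm

end Subshift

namespace Subshift

/-! ### Existence of measures of maximal pressure -/

section
variable {A : Type*} [TopologicalSpace A] [MeasurableSpace A] [Fintype A]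
  [MeasurableSingletonClass A] {X : Subshift A}

theorem shannonEntropy_word_le (ν : Measure X) [IsProbabilityMeasure ν] (n k : ℕ) :
    shannonEntropy ν (fun x => X.word n (X.shift^[k] x)) ≤ n * Real.log (Fintype.card A) := by
  refine (shannonEntropy_le_log_card ν
    ((X.measurable_word n).comp (X.measurable_shift.iterate k))).trans_eq ?_
  simp

theorem shannonEntropy_word_add_le (ν : Measure X) [IsProbabilityMeasure ν] (k m n : ℕ) :
    shannonEntropy ν (fun x => X.word (m + n) (X.shift^[k] x)) ≤
      shannonEntropy ν (fun x => X.word m (X.shift^[k] x)) +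
        shannonEntropy ν (fun x => X.word n (X.shift^[k + m] x)) := by
  have h1 := (X.measurable_word m).comp (X.measurable_shift.iterate k)
  have h2 := (X.measurable_word n).comp (X.measurable_shift.iterate (k + m))
  refine (shannonEntropy_le_of_determined ν (h1.prodMk h2) _ fun x y hxy => ?_).trans
    (shannonEntropy_prod_le ν h1 h2)
  obtain ⟨ha, hb⟩ := Prod.mk.inj hxy
  refine X.word_eq_iff.mpr fun i hi => ?_
  rcases lt_or_ge i m with him | him
  · exact X.word_eq_iff.mp ha i him
  · have := X.word_eq_iff.mp hb (i - m) (by omega)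
    rw [iterate_shift_apply, iterate_shift_apply] at this ⊢
    rwa [show i - m + (k + m) = i + k by omega] at this

theorem shannonEntropy_word_mul_le (ν : Measure X) [IsProbabilityMeasure ν] (k p q : ℕ) :
    shannonEntropy ν (fun x => X.word (p * q) (X.shift^[k] x)) ≤
      ∑ i ∈ Finset.range p, shannonEntropy ν (fun x => X.word q (X.shift^[k + i * q] x)) := by
  induction p with
  | zero =>
    rw [Nat.zero_mul]
    simpa using shannonEntropy_word_le ν 0 k
  | succ p ih =>
    rw [Nat.succ_mul, Finset.sum_range_succ]
    exact (shannonEntropy_word_add_le ν k (p * q) q).trans (by linarith)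

theorem sum_range_sum_range_mul (f : ℕ → ℝ) (p q : ℕ) :
    ∑ s ∈ Finset.range q, ∑ i ∈ Finset.range p, f (s + i * q) =
      ∑ k ∈ Finset.range (p * q), f k := by
  rw [Finset.sum_comm]
  induction p with
  | zero => simp
  | succ p ih =>
    rw [Finset.sum_range_succ, ih, Nat.succ_mul, Finset.sum_range_add]
    simp only [Nat.add_comm]

/-- The entropy of long words is controlled by the entropies of the words of length `q`
along the orbit. -/
theorem mul_shannonEntropy_word_le (ν : Measure X) [IsProbabilityMeasure ν] (n : ℕ) {q : ℕ}
    (hq : 0 < q) :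
    q * shannonEntropy ν (X.word n) ≤
      ∑ k ∈ Finset.range n, shannonEntropy ν (fun x => X.word q (X.shift^[k] x)) +
        2 * (q * (q * Real.log (Fintype.card A))) := by
  set F : ℕ → ℝ := fun k => shannonEntropy ν (fun x => X.word q (X.shift^[k] x)) with hF
  have hF0 : ∀ k, 0 ≤ F k := fun k => shannonEntropy_nonneg ν _
  have hFle : ∀ k, F k ≤ q * Real.log (Fintype.card A) := fun k => shannonEntropy_word_le ν q k
  have hlog : 0 ≤ Real.log (Fintype.card A) := Real.log_natCast_nonneg _
  set p := n / q + 1 with hp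
  have hn1 : n < p * q := by
    have := Nat.lt_div_mul_add (a := n) hq
    rw [hp, Nat.succ_mul]
    omega
  have hn2 : p * q ≤ n + q := by
    have := Nat.div_mul_le_self n q
    rw [hp, Nat.succ_mul]
    omega
  -- Cut into blocks of length `q` starting at offset `s`. Summed over all offsets, every starting
  -- time below `p * q` occurs exactly once.
  have h1 : ∀ s ∈ Finset.range q, shannonEntropy ν (X.word n) ≤
      q * Real.log (Fintype.card A) + ∑ i ∈ Finset.range p, F (s + i * q) := by
    intro s hs
    have h2 : shannonEntropy ν (X.word n) ≤ shannonEntropy ν (X.word (s + p * q)) :=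
      shannonEntropy_le_of_determined ν (X.measurable_word _) _ fun x y hxy =>
        X.word_mono (by omega) hxy
    have h3 := shannonEntropy_word_add_le ν 0 s (p * q)
    have h4 := shannonEntropy_word_mul_le ν (0 + s) p q
    have h5 := shannonEntropy_word_le ν s 0
    rw [Nat.zero_add] at h3 h4
    have h6 : (s : ℝ) * Real.log (Fintype.card A) ≤ q * Real.log (Fintype.card A) :=
      mul_le_mul_of_nonneg_right (by exact_mod_cast (Finset.mem_range.mp hs).le) hlog
    exact h2.trans (h3.trans (add_le_add (h5.trans h6) h4))
  have h2 := Finset.sum_le_sum h1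
  rw [Finset.sum_add_distrib, sum_range_sum_range_mul, Finset.sum_const, Finset.sum_const,
    Finset.card_range, nsmul_eq_mul, nsmul_eq_mul] at h2
  have h3 : ∑ k ∈ Finset.range (p * q), F k ≤
      ∑ k ∈ Finset.range n, F k + q * (q * Real.log (Fintype.card A)) := by
    refine (Finset.sum_le_sum_of_subset_of_nonneg (Finset.range_subset_range.mpr hn2)
      fun k _ _ => hF0 k).trans ?_
    rw [Finset.sum_range_add]
    refine add_le_add_right ((Finset.sum_le_sum fun k _ => hFle _).trans_eq ?_) _
    simp
  linarith

end

/-! ### Orbit averages and their weak limits -/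

section
variable {A : Type*} [TopologicalSpace A] [MeasurableSpace A] {X : Subshift A}

/-- The average of the images of a measure along the first `n` iterates of the shift. -/
noncomputable def orbitAverage (X : Subshift A) (n : ℕ) (ν : Measure X) : Measure X :=
  (n : ENNReal)⁻¹ • ∑ k ∈ Finset.range n, ν.map X.shift^[k]

theorem isProbabilityMeasure_orbitAverage {n : ℕ} (hn : n ≠ 0) (ν : Measure X)
    [IsProbabilityMeasure ν] : IsProbabilityMeasure (X.orbitAverage n ν) := by
  refine ⟨?_⟩
  have h1 : ∀ k, (ν.map X.shift^[k]) Set.univ = 1 := fun k => by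
    rw [Measure.map_apply (X.measurable_shift.iterate k) MeasurableSet.univ]
    simp
  simp only [orbitAverage, Measure.smul_apply, Measure.coe_finsetSum, Finset.sum_apply, h1,
    smul_eq_mul, Finset.sum_const, Finset.card_range, nsmul_eq_mul, mul_one]
  exact ENNReal.inv_mul_cancel (by exact_mod_cast hn) (ENNReal.natCast_ne_top n)

theorem measureReal_orbitAverage (n : ℕ) (ν : Measure X) [IsProbabilityMeasure ν] {s : Set X}
    (hs : MeasurableSet s) : (X.orbitAverage n ν).real s =
      ∑ k ∈ Finset.range n, (n : ℝ)⁻¹ * ν.real (X.shift^[k] ⁻¹' s) := by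
  rw [orbitAverage, measureReal_ennreal_smul_apply, Measure.real, Measure.coe_finsetSum,
    Finset.sum_apply, ENNReal.toReal_sum, ← Finset.mul_sum]
  · simp only [ENNReal.toReal_inv, ENNReal.toReal_natCast]
    congr 1
    refine Finset.sum_congr rfl fun k _ => ?_
    rw [Measure.map_apply (X.measurable_shift.iterate k) hs]
    rfl
  · intro k _
    rw [Measure.map_apply (X.measurable_shift.iterate k) hs]
    exact measure_ne_top _ _

end

section
variable {A : Type*} [TopologicalSpace A] [DiscreteTopology A] [Fintype A] {X : Subshift A}

/-- The cylinder is compact and the Birkhoff sum continuous, so the supremum is attained. Stating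
this as an implication allows a point to be chosen for all words at once, including those with empty
cylinder. -/
theorem exists_weight_eq [Nonempty X] (φ : C(X, ℝ)) (n : ℕ) (w : Fin n → A) :
    ∃ x : X, X.weight φ n w ≠ 0 →
      X.word n x = w ∧ X.weight φ n w = Real.exp (birkhoffSum X.shift φ n x) := by
  by_cases h0 : X.weight φ n w = 0
  · exact ⟨Classical.arbitrary X, fun h => absurd h0 h⟩
  · have hcl : IsClosed (X.word n ⁻¹' {w}) := (isClosed_discrete _).preimage (X.continuous_word n)
    have hcont : Continuous (birkhoffSum X.shift φ n) :=
      continuous_finsetSum _ fun i _ => φ.continuous.comp (X.continuous_shift.iterate i)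
    obtain ⟨x, hx, hmax⟩ := hcl.isCompact.exists_isMaxOn
      (exists_word_eq_of_weight_ne_zero h0) hcont.continuousOn
    refine ⟨x, fun _ => ⟨hx, le_antisymm ?_ ?_⟩⟩
    · exact weight_le (Real.exp_pos _).le fun y hy => Real.exp_le_exp.mpr (hmax hy)
    · have := exp_le_weight (b := ‖φ‖) (fun x => φ.norm_coe_le_norm x) n x
      rwa [show X.word n x = w from hx] at this

variable [MeasurableSpace A] [BorelSpace A]

/-- A measure on the words of length `n` realizing the partition sum. -/
theorem exists_measure_logPartitionSum_le [Nonempty X] (φ : C(X, ℝ)) (n : ℕ) :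
    ∃ ν : Measure X, IsProbabilityMeasure ν ∧ logPartitionSum X φ n ≤
      shannonEntropy ν (X.word n) + ∫ x, birkhoffSum X.shift φ n x ∂ν := by
  classical
  have hb : ∀ x, |φ x| ≤ ‖φ‖ := fun x => φ.norm_coe_le_norm x
  choose x hx using exists_weight_eq (X := X) φ n
  set Z := X.partitionSum φ n Set.univ with hZ
  have hZ0 : 0 < Z := partitionSum_pos hb n
  -- The equality case of Gibbs' inequality: probabilities proportional to the weights, placed at
  -- points where the weights are attained.
  set p : (Fin n → A) → ℝ := fun w => X.weight φ n w / Z with hp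
  have hp0 : ∀ w, 0 ≤ p w := fun w => div_nonneg (weight_nonneg _ _) hZ0.le
  have hp1 : ∑ w, p w = 1 := by
    rw [hp, ← Finset.sum_div, sum_weight_eq, div_self hZ0.ne']
  let ν : Measure X := ∑ w, ENNReal.ofReal (p w) • Measure.dirac (x w)
  have hνp : IsProbabilityMeasure ν := by
    refine ⟨?_⟩
    simp only [ν, Measure.coe_finsetSum, Finset.sum_apply, Measure.smul_apply, measure_univ,
      smul_eq_mul, mul_one]
    rw [← ENNReal.ofReal_sum_of_nonneg fun w _ => hp0 w, hp1, ENNReal.ofReal_one]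
  have hword : ∀ w, ν.real (X.word n ⁻¹' {w}) = p w := by
    intro w
    have hms : MeasurableSet (X.word n ⁻¹' {w}) := X.measurable_word n (measurableSet_singleton w)
    have h1 : ν (X.word n ⁻¹' {w}) = ENNReal.ofReal (p w) := by
      simp only [ν, Measure.coe_finsetSum, Finset.sum_apply, Measure.smul_apply, smul_eq_mul]
      rw [Finset.sum_eq_single w]
      · by_cases h0 : X.weight φ n w = 0
        · simp [hp, h0]
        · rw [Measure.dirac_apply' _ hms, Set.indicator_of_mem]
          · simp
          · exact (hx w h0).1
      · intro v _ hv
        by_cases h0 : X.weight φ n v = 0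
        · simp [hp, h0]
        · rw [Measure.dirac_apply' _ hms, Set.indicator_of_notMem]
          · simp
          · intro h
            exact hv ((hx v h0).1.symm.trans h)
      · simp
    rw [Measure.real, h1, ENNReal.toReal_ofReal (hp0 w)]
  have hm := measurable_birkhoffSum φ.continuous.measurable n (X := X)
  have hint : ∫ y, birkhoffSum X.shift φ n y ∂ν =
      ∑ w, p w * birkhoffSum X.shift φ n (x w) := by
    rw [integral_finsetSum_measure]
    · refine Finset.sum_congr rfl fun w _ => ?_
      rw [integral_smul_measure, integral_dirac' _ _ hm.stronglyMeasurable,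
        ENNReal.toReal_ofReal (hp0 w), smul_eq_mul]
    · intro w _
      exact (integrable_birkhoffSum φ.continuous.measurable hb _ n).smul_measure
        ENNReal.ofReal_ne_top
  refine ⟨ν, hνp, le_of_eq ?_⟩
  rw [hint]
  have hH : shannonEntropy ν (X.word n) = ∑ w, Real.negMulLog (p w) :=
    Finset.sum_congr rfl fun w _ => by rw [hword]
  rw [hH, ← Finset.sum_add_distrib]
  have hterm : ∀ w, Real.negMulLog (p w) + p w * birkhoffSum X.shift φ n (x w) =
      p w * logPartitionSum X φ n := by
    intro w
    by_cases h0 : X.weight φ n w = 0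
    · simp [hp, h0]
    · have h1 : Real.log (p w) = birkhoffSum X.shift φ n (x w) - logPartitionSum X φ n := by
        rw [hp, Real.log_div h0 hZ0.ne', (hx w h0).2, Real.log_exp]
        rfl
      rw [Real.negMulLog, h1]
      ring
  rw [Finset.sum_congr rfl fun w _ => hterm w, ← Finset.sum_mul, hp1, one_mul]

theorem integral_orbitAverage (n : ℕ) (ν : Measure X) [IsProbabilityMeasure ν] (f : C(X, ℝ)) :
    ∫ x, f x ∂(X.orbitAverage n ν) = (n : ℝ)⁻¹ * ∫ x, birkhoffSum X.shift f n x ∂ν := by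
  have hb : ∀ x, |f x| ≤ ‖f‖ := fun x => f.norm_coe_le_norm x
  have hm := fun k => X.measurable_shift.iterate k
  rw [orbitAverage, integral_smul_measure, integral_finsetSum_measure]
  · simp only [birkhoffSum]
    rw [integral_finsetSum]
    · simp only [ENNReal.toReal_inv, ENNReal.toReal_natCast, smul_eq_mul]
      congr 1
      refine Finset.sum_congr rfl fun k _ => ?_
      exact integral_map (hm k).aemeasurable f.continuous.measurable.aestronglyMeasurable
    · intro k _
      exact Integrable.of_bound (f.continuous.measurable.comp (hm k)).aestronglyMeasurable ‖f‖
        (ae_of_all _ fun x => hb _)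
  · intro k _
    have := Measure.isProbabilityMeasure_map (μ := ν) (hm k).aemeasurable
    exact integrable_of_abs_le f.continuous.measurable hb _

/-- Approximately invariant measures of approximately maximal pressure. -/
theorem exists_measure_approx [Nonempty X] (φ : C(X, ℝ)) {P : ℝ} (hP : X.IsPressure φ P) {n : ℕ}
    (hn : n ≠ 0) :
    ∃ μ : Measure X, IsProbabilityMeasure μ ∧
      (∀ q : ℕ, 0 < q → q * P ≤ shannonEntropy μ (X.word q) + q * ∫ x, φ x ∂μ +
        2 * (q * (q * Real.log (Fintype.card A))) / n) ∧
      ∀ f : C(X, ℝ), |∫ x, f (X.shift x) ∂μ - ∫ x, f x ∂μ| ≤ 2 * ‖f‖ / n := by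
  have hn0 : (0 : ℝ) < n := by exact_mod_cast Nat.pos_of_ne_zero hn
  obtain ⟨ν, hν, hle⟩ := exists_measure_logPartitionSum_le φ n
  have hprob := isProbabilityMeasure_orbitAverage hn ν
  refine ⟨X.orbitAverage n ν, hprob, fun q hq => ?_, fun f => ?_⟩
  · have h1 := (hP.2 n).trans hle
    have h2 := mul_shannonEntropy_word_le ν n hq
    -- By concavity, the average of the entropies of the length-`q` words along the orbit is at most
    -- the entropy of the averaged measure.
    have h3 := sum_shannonEntropy_le (Finset.range n) (fun _ => (n : ℝ)⁻¹)
      (fun _ _ => by positivity) (by simp [hn0.ne']) (X.orbitAverage n ν) (X.word q)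
      (fun _ => ν) (fun k x => X.word q (X.shift^[k] x)) (fun w => by
        rw [measureReal_orbitAverage n ν (X.measurable_word q (measurableSet_singleton w))]
        rfl)
    rw [← Finset.mul_sum, inv_mul_le_iff₀ hn0] at h3
    rw [integral_orbitAverage]
    refine le_of_mul_le_mul_left ?_ hn0
    have h4 := mul_le_mul_of_nonneg_left h1 (q.cast_nonneg (α := ℝ))
    have h5 : (n : ℝ) * (shannonEntropy (X.orbitAverage n ν) (X.word q) +
        q * ((n : ℝ)⁻¹ * ∫ x, birkhoffSum X.shift φ n x ∂ν) +
        2 * (q * (q * Real.log (Fintype.card A))) / n) =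
        n * shannonEntropy (X.orbitAverage n ν) (X.word q) +
        q * (∫ x, birkhoffSum X.shift φ n x ∂ν) + 2 * (q * (q * Real.log (Fintype.card A))) := by
      field_simp
    rw [h5]
    linarith
  · have h1 := integral_orbitAverage n ν f
    have h2 := integral_orbitAverage n ν (f.comp ⟨X.shift, X.continuous_shift⟩)
    simp only [ContinuousMap.comp_apply, ContinuousMap.coe_mk] at h2
    have hb : ∀ x, |f x| ≤ ‖f‖ := fun x => f.norm_coe_le_norm x
    have hi := integrable_birkhoffSum f.continuous.measurable hb ν n
    have hi' := integrable_birkhoffSum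
      (φ := fun x => f (X.shift x)) (f.continuous.comp X.continuous_shift).measurable
      (fun x => hb _) ν n
    -- The sums telescope: only the two ends of the orbit segment violate invariance.
    have h3 : (∫ x, birkhoffSum X.shift (fun x => f (X.shift x)) n x ∂ν) -
        ∫ x, birkhoffSum X.shift f n x ∂ν = ∫ x, (f (X.shift^[n] x) - f x) ∂ν := by
      rw [← integral_sub hi' hi]
      refine integral_congr_ae (ae_of_all _ fun x => ?_)
      dsimp only
      rw [← birkhoffSum_apply_sub_birkhoffSum]
      congr 1
      refine Finset.sum_congr rfl fun k _ => ?_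
      dsimp only
      rw [← Function.iterate_succ_apply' X.shift k x, Function.iterate_succ_apply]
    have h4 : |∫ x, (f (X.shift^[n] x) - f x) ∂ν| ≤ 2 * ‖f‖ := by
      have := norm_integral_le_of_norm_le_const (μ := ν) (C := 2 * ‖f‖)
        (f := fun x => f (X.shift^[n] x) - f x) (ae_of_all _ fun x => by
          have h5 := abs_sub (f (X.shift^[n] x)) (f x)
          have h6 := hb (X.shift^[n] x)
          have h7 := hb x
          rw [Real.norm_eq_abs]
          linarith)
      simpa using this
    have h5 : ∫ x, f (X.shift x) ∂(X.orbitAverage n ν) =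
      (n : ℝ)⁻¹ * ∫ x, birkhoffSum X.shift (fun x => f (X.shift x)) n x ∂ν := h2
    rw [h5, h1, ← mul_sub, h3, abs_mul, abs_of_pos (inv_pos.mpr hn0), inv_mul_eq_div]
    exact div_le_div_of_nonneg_right h4 hn0.le

/-- For fixed `q` both the entropy of the words of length `q` and the integral of `φ` are continuous
in the weak topology, and the errors are `O(1 / n)`; hence the inequalities survive in the limit. -/
theorem exists_hasMaximalPressure [Nonempty X] (φ : C(X, ℝ)) {P : ℝ} (hP : X.IsPressure φ P) :
    ∃ μ : Measure X, X.HasMaximalPressure φ P μ := by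
  classical
  choose μ hμp hμH hμT using fun n : ℕ => exists_measure_approx φ hP (Nat.succ_ne_zero n)
  let m : ℕ → ProbabilityMeasure X := fun n => ⟨μ n, hμp n⟩
  -- Along a nonprincipal ultrafilter the measures converge by compactness, without passing to a
  -- subsequence.
  let U : Ultrafilter ℕ := hyperfilter ℕ
  have hU : (U : Filter ℕ) ≤ atTop := Nat.hyperfilter_le_atTop
  obtain ⟨κ, -, hκ⟩ := (isCompact_univ (X := ProbabilityMeasure X)).ultrafilter_le_nhds (U.map m)
    (by simp)
  have hlim : ∀ f : C(X, ℝ),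
      Tendsto (fun n => ∫ x, f x ∂(μ n)) U (𝓝 (∫ x, f x ∂(κ : Measure X))) := fun f =>
    (ProbabilityMeasure.tendsto_iff_forall_integral_tendsto (F := (U : Filter ℕ)) (μs := m)).mp hκ
      (BoundedContinuousFunction.mkOfCompact f)
  have hdiv : ∀ c : ℝ, Tendsto (fun n : ℕ => c / ((n + 1 : ℕ) : ℝ)) U (𝓝 0) := fun c =>
    ((tendsto_const_div_atTop_nhds_zero_nat c).comp (tendsto_add_atTop_nat 1)).mono_left hU
  refine ⟨κ, κ.2, ⟨X.measurable_shift, ?_⟩, fun q => ?_⟩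
  · have := Measure.isProbabilityMeasure_map (μ := (κ : Measure X)) X.measurable_shift.aemeasurable
    refine ext_of_forall_integral_eq_of_IsFiniteMeasure fun f => ?_
    rw [integral_map X.measurable_shift.aemeasurable
      f.continuous.measurable.aestronglyMeasurable]
    have h1 := hlim f.toContinuousMap
    have h2 := hlim (f.toContinuousMap.comp ⟨X.shift, X.continuous_shift⟩)
    have h3 := (h2.sub h1).abs
    have h4 := le_of_tendsto_of_tendsto h3 (hdiv (2 * ‖f.toContinuousMap‖))
      (Eventually.of_forall fun n => hμT n f.toContinuousMap)
    exact sub_eq_zero.mp (abs_eq_zero.mp (le_antisymm h4 (abs_nonneg _)))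
  · rcases q.eq_zero_or_pos with rfl | hq
    · simpa using shannonEntropy_nonneg (κ : Measure X) (X.word 0)
    have hword : ∀ w : Fin q → A, Tendsto (fun n => (μ n).real (X.word q ⁻¹' {w})) U
        (𝓝 ((κ : Measure X).real (X.word q ⁻¹' {w}))) := by
      intro w
      -- Cylinders are clopen, so their indicators are continuous test functions.
      have h1 := hlim ⟨fun x => (Pi.single w 1 : (Fin q → A) → ℝ) (X.word q x),
        continuous_of_discreteTopology.comp (X.continuous_word q)⟩
      have h2 : ∀ ν : Measure X, IsFiniteMeasure ν →
          ∫ x, (Pi.single w 1 : (Fin q → A) → ℝ) (X.word q x) ∂ν =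
            ν.real (X.word q ⁻¹' {w}) := fun ν hν => by
        rw [(integral_comp_word ν q _).2, Finset.sum_eq_single w]
        · simp
        · intro v _ hv
          simp [hv]
        · simp
      rw [← h2 (κ : Measure X) inferInstance]
      exact h1.congr fun n => h2 _ inferInstance
    have hH : Tendsto (fun n => shannonEntropy (μ n) (X.word q)) U
        (𝓝 (shannonEntropy (κ : Measure X) (X.word q))) :=
      tendsto_finsetSum _ fun w _ => (Real.continuous_negMulLog.tendsto _).comp (hword w)
    have h5 := (hH.add ((hlim φ).const_mul (q : ℝ))).add
      (hdiv (2 * (q * (q * Real.log (Fintype.card A)))))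
    rw [add_zero] at h5
    exact ge_of_tendsto h5 (Eventually.of_forall fun n => hμH n q hq)

end

end Subshift

namespace Subshift

/-! ### Equilibrium states -/

section
variable {A : Type*} [TopologicalSpace A] [DiscreteTopology A] [MeasurableSpace A] [BorelSpace A]
  [Fintype A] {X : Subshift A} {φ : C(X, ℝ)} {P : ℝ}

/-- The upper half of the variational principle: bound the entropy by that of the words of length
`n`, apply Gibbs' inequality and let `n` tend to infinity. -/
theorem ksEntropy_add_integral_le (hP : X.IsPressure φ P) {ν : Measure X}
    (hν : IsInvariantProbability X ν) :
    ksEntropy X.shift ν + ((∫ x, φ x ∂ν : ℝ) : EReal) ≤ P := by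
  have := hν.1
  have hb : ∀ x, |φ x| ≤ ‖φ‖ := fun x => φ.norm_coe_le_norm x
  have h1 : ksEntropy X.shift ν ≤ ((P - ∫ x, φ x ∂ν : ℝ) : EReal) := by
    have hlim : Tendsto (fun n : ℕ => ((logPartitionSum X φ n / n - ∫ x, φ x ∂ν : ℝ) : EReal))
        atTop (𝓝 ((P - ∫ x, φ x ∂ν : ℝ) : EReal)) :=
      (continuous_coe_real_ereal.tendsto _).comp (hP.1.sub_const _)
    refine ge_of_tendsto hlim ?_
    filter_upwards [eventually_gt_atTop 0] with n hn
    refine (X.ksEntropy_le ν hν.2 hn.ne').trans (EReal.coe_le_coe_iff.mpr ?_)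
    have hn0 : (0 : ℝ) < n := by exact_mod_cast hn
    have h2 := shannonEntropy_word_add_integral_le_log φ.continuous.measurable hb ν n
    rw [integral_birkhoffSum φ.continuous.measurable hb ν hν.2] at h2
    rw [div_le_iff₀ hn0, sub_mul, div_mul_cancel₀ _ hn0.ne']
    linarith
  refine (add_le_add_left h1 _).trans_eq ?_
  rw [← EReal.coe_add, sub_add_cancel]

/-- The partition according to the first symbol already achieves this rate. It is relabelled by
`Fin` to fit the definition of the entropy. -/
theorem HasMaximalPressure.le_ksEntropy_add_integral {μ : Measure X}
    (hμ : X.HasMaximalPressure φ P μ) :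
    (P : EReal) ≤ ksEntropy X.shift μ + ((∫ x, φ x ∂μ : ℝ) : EReal) := by
  have := hμ.isProbabilityMeasure
  have h1 : ((P - ∫ x, φ x ∂μ : ℝ) : EReal) ≤ ksEntropy X.shift μ := by
    let e := Fintype.equivFin A
    have hξ : Measurable fun x : X => e (x.1 0) :=
      (measurable_from_top (f := e)).comp ((X.measurable_symbol 0).mono le_rfl
        (fun s _ => s.toFinite.measurableSet))
    refine le_iSup_of_le (Fintype.card A) (le_iSup_of_le (fun x => e (x.1 0))
      (le_iSup_of_le hξ ?_))
    refine le_limsup_of_frequently_le (Eventually.frequently ?_) (by isBoundedDefault)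
    filter_upwards [eventually_gt_atTop 0] with n hn
    have hn0 : (0 : ℝ) < n := by exact_mod_cast hn
    refine EReal.coe_le_coe_iff.mpr ?_
    rw [le_div_iff₀ hn0, refinedEntropy_eq_shannonEntropy]
    have h2 : shannonEntropy μ (X.word n) ≤
        shannonEntropy μ (itinerary X.shift (fun x => e (x.1 0)) n) := by
      refine shannonEntropy_le_of_determined μ (measurable_itinerary X.measurable_shift hξ n) _
        fun x y hxy => ?_
      rw [word_eq_itinerary]
      funext i
      exact e.injective (congrFun hxy i)
    have h3 := hμ.le n
    linarith
  refine le_trans (le_of_eq ?_) (add_le_add_left h1 _)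
  rw [← EReal.coe_add, sub_add_cancel]

/-- The entropy is at most the normalized word entropy for each single `n`, not only in the limit;
this is what makes the lower bound uniform in `n`. -/
theorem hasMaximalPressure_of_le_ksEntropy_add_integral {ν : Measure X}
    (hν : IsInvariantProbability X ν)
    (h : (P : EReal) ≤ ksEntropy X.shift ν + ((∫ x, φ x ∂ν : ℝ) : EReal)) :
    X.HasMaximalPressure φ P ν := by
  have := hν.1
  refine ⟨hν.1, hν.2, fun n => ?_⟩
  rcases n.eq_zero_or_pos with rfl | hn
  · simpa using shannonEntropy_nonneg ν (X.word 0)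
  have hn0 : (0 : ℝ) < n := by exact_mod_cast hn
  have h1 := h.trans (add_le_add_left (X.ksEntropy_le ν hν.2 hn.ne') _)
  rw [← EReal.coe_add, EReal.coe_le_coe_iff] at h1
  have h2 := mul_le_mul_of_nonneg_left h1 hn0.le
  rwa [mul_add, mul_div_cancel₀ _ hn0.ne'] at h2

theorem IsGoodDecomposition.existsUnique_isEquilibriumState [Nonempty X]
    {G S : ∀ n, Set (Fin n → A)} {r B : ℕ} {K s : ℝ} (h : X.IsGoodDecomposition φ G S r B K)
    (hP : X.IsPressure φ P) (hs : ∀ x, φ x ≤ s) (hsP : s < P) :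
    ∃! μ : Measure X, IsEquilibriumState X φ μ := by
  obtain ⟨μ, hμ⟩ := exists_hasMaximalPressure φ hP
  have hinv : IsInvariantProbability X μ := ⟨hμ.isProbabilityMeasure, hμ.measurePreserving⟩
  refine ⟨μ, ⟨hinv, fun ν hν => (ksEntropy_add_integral_le hP hν).trans
    hμ.le_ksEntropy_add_integral⟩, fun ν hν => ?_⟩
  have hν' := hasMaximalPressure_of_le_ksEntropy_add_integral hν.1
    (hμ.le_ksEntropy_add_integral.trans (hν.2 μ hinv))
  exact hν'.eq h φ.continuous.measurable (fun x => φ.norm_coe_le_norm x) hP hs hsP hμ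

end

/-! ### Words as lists -/

section
variable {A : Type*} [TopologicalSpace A] (X : Subshift A)

/-- The initial word of length `n` of a point, as a list. -/
def wordList (n : ℕ) (x : X) : List A := List.ofFn (X.word n x)

@[simp] theorem length_wordList (n : ℕ) (x : X) : (X.wordList n x).length = n :=
  List.length_ofFn

theorem getElem_wordList {n : ℕ} {x : X} {i : ℕ} (h : i < (X.wordList n x).length) :
    (X.wordList n x)[i] = x.1 i := by
  simp [wordList, word]

theorem mem_cylinder_iff {w : List A} {x : X} :
    x ∈ X.cylinder w ↔ X.wordList w.length x = w := by
  constructor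
  · intro h
    refine List.ext_getElem (by simp) fun i h1 h2 => ?_
    rw [getElem_wordList]
    exact h i h2
  · intro h i hi
    rw [← X.getElem_wordList (n := w.length) (by simpa using hi)]
    simp only [h]

theorem mem_cylinder_wordList {n : ℕ} {x y : X} :
    y ∈ X.cylinder (X.wordList n x) ↔ X.word n y = X.word n x := by
  rw [mem_cylinder_iff, length_wordList, wordList, wordList, List.ofFn_inj]

theorem mem_language_iff {w : List A} : w ∈ X.language ↔ ∃ x, X.wordList w.length x = w :=
  exists_congr fun _ => X.mem_cylinder_iff

theorem wordList_mem_language (n : ℕ) (x : X) : X.wordList n x ∈ X.language :=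
  X.mem_language_iff.mpr ⟨x, by simp⟩

/-- Every word of the language has weight at least `exp (n * i)`. This puts the pressure above
topological entropy plus `inf φ`. -/
theorem ncard_language_mul_exp_le [Fintype A] {φ : X → ℝ} {b i : ℝ} (hb : ∀ x, |φ x| ≤ b)
    (hi : ∀ x, i ≤ φ x) (n : ℕ) :
    ({w | w ∈ X.language ∧ w.length = n}.ncard : ℝ) * Real.exp (n * i) ≤
      X.partitionSum φ n Set.univ := by
  classical
  have h1 : {w | w ∈ X.language ∧ w.length = n} ⊆ List.ofFn '' Set.range (X.word n) := by
    rintro w ⟨hw, rfl⟩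
    obtain ⟨x, hx⟩ := X.mem_language_iff.mp hw
    exact ⟨X.word w.length x, ⟨x, rfl⟩, hx⟩
  have h2 : {w | w ∈ X.language ∧ w.length = n}.ncard ≤ (Set.range (X.word n)).ncard :=
    (Set.ncard_le_ncard h1 (Set.toFinite _)).trans (Set.ncard_image_le (Set.toFinite _))
  have h3 : ((Set.range (X.word n)).ncard : ℝ) * Real.exp (n * i) ≤
      X.partitionSum φ n (Set.range (X.word n)) := by
    rw [Set.ncard_eq_toFinset_card', ← nsmul_eq_mul, partitionSum]
    refine le_trans (le_of_eq ?_) (Finset.card_nsmul_le_sum _ _ (Real.exp (n * i)) fun w hw => ?_)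
    · congr 2
      ext w
      simp
    · obtain ⟨x, rfl⟩ := (Finset.mem_filter.mp hw).2
      refine le_trans (Real.exp_le_exp.mpr ?_) (exp_le_weight hb n x)
      refine le_trans (le_of_eq ?_) (Finset.sum_le_sum fun k _ => hi _)
      simp
  refine (mul_le_mul_of_nonneg_right ?_ (Real.exp_pos _).le).trans
    (h3.trans (partitionSum_mono (Set.subset_univ _)))
  exact_mod_cast h2

/-- A function of small oscillation has pressure larger than its supremum. -/
theorem lt_pressure_of_lt_topEntropy [Fintype A] [Nonempty X] {φ : X → ℝ} {b i s P : ℝ}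
    (hb : ∀ x, |φ x| ≤ b)
    (hi : ∀ x, i ≤ φ x) (hP : X.IsPressure φ P) (h : ((s - i : ℝ) : EReal) < X.topEntropy) :
    s < P := by
  obtain ⟨c, hc1, hc2⟩ := EReal.lt_iff_exists_real_btwn.mp h
  have hc1' : s - i < c := by exact_mod_cast hc1
  by_contra! hcon
  have h1 := frequently_lt_of_lt_limsup (by isBoundedDefault) hc2
  have h2 := hP.1.eventually (gt_mem_nhds (show P < c + i by linarith))
  obtain ⟨n, hn, hnP, hn0⟩ := (h1.and_eventually (h2.and (eventually_gt_atTop 0))).exists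
  have hn0' : (0 : ℝ) < n := by exact_mod_cast hn0
  have hn' : c < Real.log ({w | w ∈ X.language ∧ w.length = n}.ncard : ℝ) / n := by
    exact_mod_cast hn
  have hcard : (0 : ℝ) < ({w | w ∈ X.language ∧ w.length = n}.ncard : ℝ) := by
    have hfin : {w | w ∈ X.language ∧ w.length = n}.Finite :=
      (List.finite_length_eq A n).subset fun w hw => hw.2
    obtain ⟨x⟩ := ‹Nonempty X›
    exact_mod_cast (Set.ncard_pos hfin).mpr ⟨_, X.wordList_mem_language n x, by simp⟩
  have h3 := Real.log_le_log (by positivity) (X.ncard_language_mul_exp_le hb hi n)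
  rw [Real.log_mul hcard.ne' (Real.exp_pos _).ne', Real.log_exp] at h3
  rw [div_lt_iff₀ hn0', logPartitionSum] at hnP
  rw [lt_div_iff₀ hn0'] at hn'
  linarith

end

end Subshift

/-! ### The `β`-shift -/

theorem toLex_le_toLex_iff {y w : ℕ → ℕ} :
    toLex y ≤ toLex w ↔ ∀ n, (∀ j < n, y j = w j) → y n ≤ w n := by
  constructor
  · intro h n hn
    by_contra! hlt
    exact not_lt.mpr h ⟨n, fun j hj => (hn j hj).symm, hlt⟩
  · intro h
    by_contra hcon
    obtain ⟨n, hn, hlt⟩ := not_le.mp hcon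
    exact not_lt.mpr (h n fun j hj => (hn j hj).symm) hlt

theorem betaRemainder_pos_and_le_one {β : ℝ} (hβ : 1 < β) (j : ℕ) :
    0 < betaRemainder β j ∧ betaRemainder β j ≤ 1 := by
  induction j with
  | zero => exact ⟨one_pos, le_rfl⟩
  | succ j ih =>
    have hpos : 0 < β * betaRemainder β j := mul_pos (by linarith) ih.1
    have h1 : 1 ≤ ⌈β * betaRemainder β j⌉₊ := Nat.one_le_ceil_iff.mpr hpos
    have h2 := Nat.le_ceil (β * betaRemainder β j)
    have h3 := Nat.ceil_lt_add_one hpos.le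
    rw [betaRemainder, Nat.cast_sub h1]
    push_cast
    constructor <;> linarith

/-- As long as the digits agree, both remainders evolve by the same increasing affine map. The
unshifted one starts from the maximal value `1`, so it stays ahead, and digits are monotone in the
remainder. -/
theorem betaDigit_shift_le {β : ℝ} (hβ : 1 < β) (i : ℕ) :
    toLex (fun j => betaDigit β (i + j)) ≤ toLex (betaDigit β) := by
  rw [toLex_le_toLex_iff]
  intro n hn
  have h : ∀ j ≤ n, betaRemainder β (i + j) ≤ betaRemainder β j := by
    intro j hj
    induction j with
    | zero => exact (betaRemainder_pos_and_le_one hβ _).2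
    | succ j ih =>
      have h1 := ih (by omega)
      have h2 := hn j (by omega)
      rw [← Nat.add_assoc, betaRemainder, betaRemainder]
      rw [betaDigit, betaDigit] at h2
      rw [h2]
      have := mul_le_mul_of_nonneg_left h1 (by linarith : 0 ≤ β)
      linarith
  exact Nat.sub_le_sub_right (Nat.ceil_mono
    (mul_le_mul_of_nonneg_left (h n le_rfl) (by linarith))) 1

theorem betaDigit_zero_pos {β : ℝ} (hβ : 1 < β) : 0 < betaDigit β 0 := by
  have : 1 < ⌈β * betaRemainder β 0⌉₊ := Nat.lt_ceil.mpr (by simpa [betaRemainder] using hβ)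
  rw [betaDigit]
  omega

section
variable {β : ℝ}

theorem BetaPath.append {i j l : ℕ} {u v : List (Fin ⌈β⌉₊)} (hu : BetaPath β i u j)
    (hv : BetaPath β j v l) : BetaPath β i (u ++ v) l := by
  induction hu with
  | nil => exact hv
  | advance ha _ ih => exact .advance ha (ih hv)
  | back ha _ ih => exact .back ha (ih hv)

theorem BetaPath.drop {i j : ℕ} {u : List (Fin ⌈β⌉₊)} (hu : BetaPath β i u j) (k : ℕ) :
    ∃ i', BetaPath β i' (u.drop k) j := by
  induction hu generalizing k with
  | nil i => exact ⟨i, by simpa using BetaPath.nil i⟩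
  | @advance i _ _ _ ha h ih =>
    cases k with
    | zero => exact ⟨i, .advance ha h⟩
    | succ k => simpa using ih k
  | @back i _ _ _ ha h ih =>
    cases k with
    | zero => exact ⟨i, .back ha h⟩
    | succ k => simpa using ih k

/-- A path to the base vertex, continued by zeros, is below the shifted expansion of `1`. -/
theorem BetaPath.toLex_le {z : Fin ⌈β⌉₊} (hz : (z : ℕ) = 0) {i j : ℕ}
    {u : List (Fin ⌈β⌉₊)} (hu : BetaPath β i u j) (hj : j = 0) :
    toLex (fun n => (u.getD n z : ℕ)) ≤ toLex fun n => betaDigit β (i + n) := by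
  rw [toLex_le_toLex_iff]
  induction hu with
  | nil => simp [hz]
  | @advance i _ a _ ha _ ih =>
    intro n hn
    cases n with
    | zero => simpa using ha.le
    | succ n =>
      have := ih hj n fun m hm => by
        simpa [Nat.add_assoc, Nat.add_comm 1] using hn (m + 1) (by omega)
      simpa [Nat.add_assoc, Nat.add_comm 1] using this
  | back ha _ _ =>
    intro n hn
    cases n with
    | zero => simpa using ha.le
    -- This case is vacuous: a return edge already makes the first digit strictly smaller.
    | succ n =>
      have := hn 0 (by omega)
      simp only [List.getD_cons_zero, Nat.add_zero] at this
      omega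

/-- Continue the word by zeros. Every tail of a loop is a path from some vertex `i` to the base,
hence lies below the expansion shifted by `i`, which lies below the expansion itself. -/
theorem exists_wordList_eq_of_mem_betaCore (hβ : 1 < β) {u : List (Fin ⌈β⌉₊)}
    (hu : u ∈ betaCore β) : ∃ p : betaShift β, (betaShift β).wordList u.length p = u := by
  let z : Fin ⌈β⌉₊ := ⟨0, Nat.ceil_pos.mpr (by linarith)⟩
  refine ⟨⟨fun n => u.getD n z, fun k => ?_⟩, ?_⟩
  · obtain ⟨i, hi⟩ := BetaPath.drop hu k
    refine le_trans (le_of_eq ?_) ((hi.toLex_le (z := z) rfl rfl).trans (betaDigit_shift_le hβ i))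
    congr 1
    funext n
    simp [List.getD_eq_getElem?_getD]
  · refine List.ext_getElem (by simp) fun i h1 h2 => ?_
    rw [Subshift.getElem_wordList]
    simp [h2]

theorem exists_mem_betaCore_length_eq (hβ : 1 < β) (r : ℕ) : ∃ u ∈ betaCore β, u.length = r := by
  let z : Fin ⌈β⌉₊ := ⟨0, Nat.ceil_pos.mpr (by linarith)⟩
  refine ⟨List.replicate r z, ?_, List.length_replicate⟩
  induction r with
  | zero => exact BetaPath.nil 0
  | succ r ih =>
    rw [List.replicate_succ]
    exact BetaPath.back (betaDigit_zero_pos hβ) ih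

end

theorem Subshift.wordList_add {A : Type*} [TopologicalSpace A] (X : Subshift A) (m n : ℕ) (x : X) :
    X.wordList (m + n) x = X.wordList m x ++ X.wordList n (X.shift^[m] x) := by
  refine List.ext_getElem (by simp) fun i h1 h2 => ?_
  rw [Subshift.getElem_wordList, List.getElem_append]
  split_ifs with h
  · rw [Subshift.getElem_wordList]
  · rw [Subshift.getElem_wordList, Subshift.iterate_shift_apply]
    rw [length_wordList] at h
    rw [length_wordList]
    exact congrArg x.1 (by omega)

section
variable {β : ℝ}

theorem betaPath_wordList (p : betaShift β) (j : ℕ) (h : ∀ i < j, (p.1 i : ℕ) = betaDigit β i) :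
    BetaPath β 0 ((betaShift β).wordList j p) j := by
  induction j with
  | zero => exact BetaPath.nil 0
  | succ j ih =>
    rw [Subshift.wordList_add]
    refine (ih fun i hi => h i (by omega)).append ?_
    have : (betaShift β).wordList 1 ((betaShift β).shift^[j] p) = [p.1 j] := by
      simp [Subshift.wordList, Subshift.word, Subshift.iterate_shift_apply]
    rw [this]
    exact BetaPath.advance (h j (by omega)) (BetaPath.nil _)

/-- Every word of the `β`-shift is a good word followed by an initial word of the expansion
of `1`. -/
theorem betaShift_decomposition (p : betaShift β) (n : ℕ) :
    ∃ k j, k + j = n ∧ (betaShift β).wordList k p ∈ betaCore β ∧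
      ∀ i < j, (p.1 (k + i) : ℕ) = betaDigit β i := by
  induction n with
  | zero => exact ⟨0, 0, rfl, BetaPath.nil 0, by simp⟩
  | succ n ih =>
    obtain ⟨k, j, rfl, hk, hj⟩ := ih
    -- Admissibility at `k` bounds the next digit. Equality prolongs the initial run of the
    -- expansion; strict inequality is a return to the base vertex and absorbs the run into the good
    -- word.
    have hle := toLex_le_toLex_iff.mp (p.2 k) j hj
    rcases hle.eq_or_lt with heq | hlt
    · refine ⟨k, j + 1, rfl, hk, fun i hi => ?_⟩
      rcases Nat.lt_succ_iff_lt_or_eq.mp hi with h | rfl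
      · exact hj i h
      · exact heq
    · refine ⟨k + j + 1, 0, rfl, ?_, by simp⟩
      rw [Nat.add_assoc, Subshift.wordList_add, Subshift.wordList_add]
      refine BetaPath.append hk ((betaPath_wordList _ j fun i hi => ?_).append ?_)
      · rw [Subshift.iterate_shift_apply, Nat.add_comm]
        exact hj i hi
      · rw [← Function.iterate_add_apply]
        have : (betaShift β).wordList 1 ((betaShift β).shift^[j + k] p) = [p.1 (k + j)] := by
          simp [Subshift.wordList, Subshift.word, Subshift.iterate_shift_apply, Nat.add_comm]
        rw [this]
        exact BetaPath.back hlt (BetaPath.nil 0)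

/-! ### Factors of the `β`-shift -/

theorem length_blockMap {A B : Type*} {r : ℕ} (θ : (Fin (r + 1) → A) → B) (w : List A) :
    (blockMap θ w).length = w.length - r := by
  simp [blockMap]

theorem blockMap_wordList {A B : Type*} [TopologicalSpace A] [TopologicalSpace B]
    {X : Subshift A} {Y : Subshift B} {π : X → Y} {r : ℕ} {θ : (Fin (r + 1) → A) → B}
    (hθ : IsBlockCode π θ) (n : ℕ) (p : X) :
    blockMap θ (X.wordList (n + r) p) = Y.wordList n (π p) := by
  refine List.ext_getElem (by simp [length_blockMap]) fun i h1 h2 => ?_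
  rw [Subshift.getElem_wordList, hθ p i]
  simp [blockMap, Subshift.getElem_wordList]

/-- Makes the length of the preimage predictable. This could fail only for the empty word, which may
come from a shorter loop; a loop of length exactly `r` replaces it. -/
theorem exists_betaCore_of_mem_inheritedCore {A : Type*} {r : ℕ}
    {θ : (Fin (r + 1) → Fin ⌈β⌉₊) → A} (hβ : 1 < β) {w : List A} (hw : w ∈ inheritedCore β θ) :
    ∃ u ∈ betaCore β, u.length = w.length + r ∧ blockMap θ u = w := by
  obtain ⟨u, hu, rfl⟩ := hw
  rw [length_blockMap]
  rcases le_total r u.length with h | h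
  · exact ⟨u, hu, by omega, rfl⟩
  · obtain ⟨v, hv, hvr⟩ := exists_mem_betaCore_length_eq hβ r
    refine ⟨v, hv, by omega, ?_⟩
    rw [List.eq_nil_of_length_eq_zero (show (blockMap θ u).length = 0 by
      rw [length_blockMap]; omega), List.eq_nil_of_length_eq_zero
      (show (blockMap θ v).length = 0 by rw [length_blockMap]; omega)]

/-- The suffix is determined by `u`: its length fixes the length of `c`, and `c` is an initial word
of one fixed sequence. -/
theorem ncard_inheritedSuffixes_le {A : Type*} {r : ℕ}
    {θ : (Fin (r + 1) → Fin ⌈β⌉₊) → A} (n : ℕ) :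
    {w : Fin n → A | List.ofFn w ∈ inheritedSuffixes β θ}.ncard ≤
      {u : List (Fin ⌈β⌉₊) | u.length ≤ r}.ncard := by
  have hex : ∀ w : Fin n → A, ∃ u : List (Fin ⌈β⌉₊), List.ofFn w ∈ inheritedSuffixes β θ →
      u.length ≤ r ∧ ∃ c ∈ betaSuffixes β, List.ofFn w = blockMap θ (u ++ c) := by
    intro w
    by_cases h : List.ofFn w ∈ inheritedSuffixes β θ
    · obtain ⟨u, hu, c, hc, -, hw⟩ := h
      exact ⟨u, fun _ => ⟨hu, c, hc, hw⟩⟩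
    · exact ⟨[], fun h' => absurd h' h⟩
  choose f hf using hex
  refine Set.ncard_le_ncard_of_injOn f (fun w hw => (hf w hw).1) ?_ (List.finite_length_le _ r)
  intro w hw w' hw' he
  -- For `n = 0` the truncated subtraction in the length of the image does not determine the length
  -- of `c`, but there is only one empty word.
  rcases n.eq_zero_or_pos with rfl | hn
  · exact Subsingleton.elim _ _
  obtain ⟨-, c, hc, h⟩ := hf w hw
  obtain ⟨-, c', hc', h'⟩ := hf w' hw'
  have hl := congrArg List.length h
  have hl' := congrArg List.length h'
  rw [List.length_ofFn, length_blockMap, List.length_append] at hl hl'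
  rw [← he] at hl' h'
  have hcc : c = c' := List.ext_getElem (by omega) fun i h1 h2 =>
    Fin.ext ((hc i h1).trans (hc' i h2).symm)
  rw [hcc, ← h'] at h
  exact List.ofFn_inj.mp h

variable {A : Type*} [TopologicalSpace A] {X : Subshift A} {π : betaShift β → X} {r : ℕ}
  {θ : (Fin (r + 1) → Fin ⌈β⌉₊) → A}

theorem IsFactorMap.map_iterate_shift (hπ : IsFactorMap π) (k : ℕ) (p : betaShift β) :
    π ((betaShift β).shift^[k] p) = X.shift^[k] (π p) :=
  Function.Semiconj.iterate_right (f := π) hπ.2.2 k p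

theorem inherited_decomposition (hπ : IsFactorMap π) (hθ : IsBlockCode π θ) (x : X) (n : ℕ) :
    ∃ k j, k + j = n ∧ X.wordList k x ∈ inheritedCore β θ ∧
      X.wordList j (X.shift^[k] x) ∈ inheritedSuffixes β θ := by
  obtain ⟨p, rfl⟩ := hπ.2.1 x
  -- A word of length `n` of the factor is read off from `n + r` symbols of the preimage.
  obtain ⟨k, j, hkj, hk, hj⟩ := betaShift_decomposition p (n + r)
  have hsuf : (betaShift β).wordList j ((betaShift β).shift^[k] p) ∈ betaSuffixes β := by
    intro i hi
    rw [Subshift.getElem_wordList, Subshift.iterate_shift_apply, Nat.add_comm]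
    exact hj i (by simpa using hi)
  -- The last `r` symbols of a long good word are shared with the windows of the suffix and become
  -- `u`. A good word shorter than that is entirely part of `u`.
  rcases le_total r k with hrk | hrk
  · obtain ⟨m, rfl⟩ : ∃ m, k = m + r := ⟨k - r, by omega⟩
    refine ⟨m, j, by omega, ⟨_, hk, blockMap_wordList hθ m p⟩,
      (betaShift β).wordList r ((betaShift β).shift^[m] p), by simp, _, hsuf, ?_⟩
    rw [Nat.add_comm m r, Function.iterate_add_apply, ← Subshift.wordList_add]
    refine ⟨Subshift.wordList_mem_language _ _ _, ?_⟩
    rw [Nat.add_comm r j, blockMap_wordList hθ, hπ.map_iterate_shift]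
  · refine ⟨0, n, by omega, ⟨[], BetaPath.nil 0, by simp [blockMap, Subshift.wordList]⟩,
      (betaShift β).wordList k p, by simpa using hrk, _, hsuf, ?_⟩
    rw [← Subshift.wordList_add, hkj, blockMap_wordList hθ]
    exact ⟨Subshift.wordList_mem_language _ _ _, rfl⟩

theorem language_eq_concat (hπ : IsFactorMap π) (hθ : IsBlockCode π θ) :
    X.language = X.concat (inheritedCore β θ) (inheritedSuffixes β θ) := by
  refine Set.Subset.antisymm (fun w hw => ⟨hw, ?_⟩) fun w hw => hw.1
  obtain ⟨x, hx⟩ := X.mem_language_iff.mp hw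
  obtain ⟨k, j, hkj, hk, hj⟩ := inherited_decomposition hπ hθ x w.length
  refine ⟨_, hk, _, hj, ?_⟩
  rw [← Subshift.wordList_add, hkj, hx]

/-- Concatenate the preimages, of lengths `m + r` and `n + r`. The block map loses `r` symbols at
the end, and the `r` windows straddling the junction form the gap. -/
theorem inherited_specification (hβ : 1 < β) (hπ : IsFactorMap π) (hθ : IsBlockCode π θ)
    {m n : ℕ} (x y : X) (hx : X.wordList m x ∈ inheritedCore β θ)
    (hy : X.wordList n y ∈ inheritedCore β θ) :
    ∃ z, X.wordList (m + r + n) z ∈ inheritedCore β θ ∧ X.wordList m z = X.wordList m x ∧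
      X.wordList n (X.shift^[m + r] z) = X.wordList n y := by
  obtain ⟨u, hu, hul, hux⟩ := exists_betaCore_of_mem_inheritedCore hβ hx
  obtain ⟨v, hv, hvl, hvy⟩ := exists_betaCore_of_mem_inheritedCore hβ hy
  rw [Subshift.length_wordList] at hul hvl
  have huv : u ++ v ∈ betaCore β := BetaPath.append hu hv
  obtain ⟨p, hp⟩ := exists_wordList_eq_of_mem_betaCore hβ huv
  rw [List.length_append, hul, hvl] at hp
  have hp' := hp
  rw [Subshift.wordList_add] at hp'
  obtain ⟨h1, h2⟩ := List.append_inj hp' (by simp [hul])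
  refine ⟨π p, ⟨u ++ v, huv, ?_⟩, ?_, ?_⟩
  · rw [← hp, ← Nat.add_assoc, blockMap_wordList hθ]
  · rw [← blockMap_wordList hθ, h1, hux]
  · rw [← hπ.map_iterate_shift, ← blockMap_wordList hθ, h2, hvy]

theorem isGoodDecomposition_inherited (hβ : 1 < β) (hπ : IsFactorMap π) (hθ : IsBlockCode π θ)
    {φ : X → ℝ} (hφ : X.HasBowenOn (inheritedCore β θ) φ) :
    ∃ K, X.IsGoodDecomposition φ (fun _ => {w | List.ofFn w ∈ inheritedCore β θ})
      (fun _ => {w | List.ofFn w ∈ inheritedSuffixes β θ}) r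
      {u : List (Fin ⌈β⌉₊) | u.length ≤ r}.ncard K := by
  obtain ⟨K, hK⟩ := hφ
  refine ⟨K, fun x y hx hy => ?_, fun x n => inherited_decomposition hπ hθ x n,
    ncard_inheritedSuffixes_le, fun x y hx hxy => ?_⟩
  · obtain ⟨z, h1, h2, h3⟩ := inherited_specification hβ hπ hθ x y hx hy
    exact ⟨z, h1, List.ofFn_inj.mp h2, List.ofFn_inj.mp h3⟩
  · have h := hK _ hx y (X.mem_cylinder_wordList.mpr hxy) x (X.mem_cylinder_wordList.mpr rfl)
    rw [List.length_ofFn] at h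
    have := le_of_abs_le h
    linarith

end

/-! ### The main theorem -/

theorem mainTheorem10 (β : ℝ) (hβ : 1 < β)
    {A : Type*} [Finite A] [TopologicalSpace A] [DiscreteTopology A]
    [MeasurableSpace A] [BorelSpace A] (X : Subshift A)
    (π : betaShift β → X) (hπ : IsFactorMap π)
    (r : ℕ) (θ : (Fin (r + 1) → Fin ⌈β⌉₊) → A) (hθ : IsBlockCode π θ)
    (φ : C(X, ℝ)) :
    X.language = X.concat (inheritedCore β θ) (inheritedSuffixes β θ) ∧
      (X.HasBowenOn (inheritedCore β θ) φ →
        (((⨆ x, φ x) - (⨅ x, φ x) : ℝ) : EReal) < X.topEntropy →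
        ∃! μ : Measure X, IsEquilibriumState X φ μ) := by
  refine ⟨language_eq_concat hπ hθ, fun hφ hgap => ?_⟩
  cases nonempty_fintype A
  -- The empty loop yields a point of the `β`-shift, so `X` is nonempty.
  obtain ⟨p, -⟩ := exists_wordList_eq_of_mem_betaCore hβ (BetaPath.nil 0)
  have : Nonempty X := ⟨π p⟩
  have hb : ∀ x, |φ x| ≤ ‖φ‖ := fun x => φ.norm_coe_le_norm x
  obtain ⟨P, hP⟩ := Subshift.exists_isPressure hb
  obtain ⟨K, hgood⟩ := isGoodDecomposition_inherited hβ hπ hθ hφ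
  have hsup : ∀ x, φ x ≤ ⨆ y, φ y := fun x =>
    le_ciSup (f := φ) ⟨‖φ‖, by rintro _ ⟨y, rfl⟩; exact (le_abs_self _).trans (hb y)⟩ x
  have hinf : ∀ x, ⨅ y, φ y ≤ φ x := fun x =>
    ciInf_le (f := φ) ⟨-‖φ‖, by rintro _ ⟨y, rfl⟩; exact neg_le_of_abs_le (hb y)⟩ x
  exact hgood.existsUnique_isEquilibriumState hP hsup
    (X.lt_pressure_of_lt_topEntropy hb hinf hP hgap)
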